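/- **Setting.** Fix an integer $L\ge 2$ and reals $0<\lambda<1$, $\sigma^2,P_{\mathsf p},P_{\max},\theta_{\mathsf p},\theta_{\mathsf s}>0$; put $\gamma_{\mathsf p}=P_{\mathsf p}/\sigma^2$, $\gamma_{\max}=P_{\max}/\sigma^2$. Let $h_{\mathsf p}\sim\mathcal{CN}(0,1)$, let $\mathbf h_{\mathsf x}\in\mathbb C^L$ have i.i.d. $\mathcal{CN}(0,\lambda)$ entries and $\mathbf h_{\mathsf s}\in\mathbb C^L$ i.i.d. $\mathcal{CN}(0,1)$ entries, all independent. Put $g_{\mathsf p}=|h_{\mathsf p}|^2$, $g_{\mathsf x}=\|\mathbf h_{\mathsf x}\|^2/\lambda$, $g_{\mathsf s}=\|\mathbf h_{\mathsf s}\|^2$, $\mathbf s_{\mathsf x}=\mathbf h_{\mathsf x}/\|\mathbf h_{\mathsf x}\|$, $\mathbf s_{\mathsf s}=\mathbf h_{\mathsf s}/\|\mathbf h_{\mathsf s}\|$. *CDI quantization ($B$ bits).* $\hat{\mathbf s}_{\mathsf x}$ is a unit vector that is a measurable function of $\mathbf s_{\mathsf x}$ and possibly of a random seed independent of all channels, such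 that $\epsilon=1-|\hat{\mathbf s}_{\mathsf x}^\dagger\mathbf s_{\mathsf x}|^2$ satisfies $\Pr(\epsilon\le\tau)=2^B\tau^{L-1}$ for $0\le\tau\le 2^{-B/(L-1)}$. Write $\mathbf s_{\mathsf s}=a\hat{\mathbf s}_{\mathsf x}+b\hat{\mathbf s}_\perp$ with $\hat{\mathbf s}_\perp$ a unit vector orthogonal to $\hat{\mathbf s}_{\mathsf x}$, and put $\delta=|\mathbf s_{\mathsf x}^\dagger\hat{\mathbf s}_\perp|^2$. *IPC signals.* Let $\omega=\sigma^2(\gamma_{\mathsf p}g_{\mathsf p}/\theta_{\mathsf p}-1)$. If $\omega\ge0$ put $\eta=\omega/(\lambda g_{\mathsf x}\epsilon)$ (no feedforward) and $\acute\eta=\omega/(\lambda g_{\mathsf x}\delta)$ (feedforward); if $\omega<0$ put $\eta=\acute\eta=P_{\max}$. *IPC quantization ($A$ bits, $N=2^A$).* The codebook $\mathcal P=\{0=p_0<p_1<\dots<p_{N-1}\}$ satisfies $\Pr(p_n<\eta\le p_{n+1}\mid\gamma_{\mathsf p}g_{\mathsf p}\ge\theta_{\mathsf p})=1/N$ for $0\le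 n\le N-2$ and $\Pr(\eta>p_{N-1}\mid\gamma_{\mathsf p}g_{\mathsf p}\ge\theta_{\mathsf p})=1/N$. With $\lfloor x\rfloor_{\mathcal P}=\max\{p\in\mathcal P:p\le x\}$, the quantized feedforward IPC signal is $\tilde\eta=\lfloor\acute\eta\rfloor_{\mathcal P}$ if $\omega\ge0$ and $\acute\eta<P_{\max}$, and $\tilde\eta=P_{\max}$ otherwise. *Beamformer and outage.* The orthogonal cognitive beamformer (OCB) $\mathbf f$ maximizes $|\mathbf f^\dagger\mathbf s_{\mathsf s}|^2$ subject to $\mathbf f^\dagger\hat{\mathbf s}_{\mathsf x}=0$ and $\|\mathbf f\|^2\le\tilde\eta$. The SU outage probability is $\acute P_{\mathsf{out}}=\Pr\big(\tfrac{g_{\mathsf s}}{\sigma^2}|\mathbf f^\dagger\mathbf s_{\mathsf s}|^2\le\theta_{\mathsf s}\big)$. **Statement.** With $\Gamma(s,x)=\int_x^\infty t^{s-1}e^{-t}\,dt$, $$\varphi=e^{-\theta_{\mathsf p}/\gamma_{\mathsf p}}\frac{(L-1)\lambda\theta_{\mathsf p}\theta_{\mathsf s}\Gamma(L-2,\theta_{\mathsf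 s}/\gamma_{\max})}{\gamma_{\mathsf p}\Gamma(L-1)},\qquad \alpha=e^{-\theta_{\mathsf p}/\gamma_{\mathsf p}}\frac{\Gamma(L-1,\theta_{\mathsf s}/\gamma_{\max})}{\Gamma(L-1)},$$ for OCB with feedforward and both quantized CDI and quantized IPC feedback $$\acute P_{\mathsf{out}}\le 1-\frac{\Gamma(L-1,\theta_{\mathsf s}/\gamma_{\max})}{\Gamma(L-1)}+\frac{\varphi\,2^{-B/(L-1)}+\alpha\,2^{-A}}{L-1}+O\big(2^{-2B/(L-1)}\big),$$ where the constant in $O(\cdot)$ depends only on $L,\lambda,\sigma^2,P_{\mathsf p},P_{\max},\theta_{\mathsf p},\theta_{\mathsf s}$; the bound holds for all integers $A,B\ge0$. -/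

import Mathlib

open MeasureTheory ProbabilityTheory Set

/-- The circularly symmetric complex Gaussian law `CN(0, v)`: real and imaginary parts are
independent real Gaussians with mean `0` and variance `v / 2`. -/
noncomputable def complexGaussian (v : NNReal) : Measure ℂ :=
  ((gaussianReal 0 (v / 2)).prod (gaussianReal 0 (v / 2))).map
    Complex.measurableEquivRealProd.symm

/-- The upper incomplete gamma function `Γ(s, x) = ∫_x^∞ t^(s-1) e^(-t) dt`. -/
noncomputable def upperGamma (s x : ℝ) : ℝ :=
  ∫ t in Ioi x, t ^ (s - 1) * Real.exp (-t)

/-- Deterministic parameters of the primary and the secondary link. -/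
structure LinkParams where
  /-- the relative path gain `λ` of the channel from the SU transmitter to the PU receiver -/
  pathGain : NNReal
  /-- the noise variance `σ²` -/
  noise : ℝ
  /-- the PU transmission power -/
  powerPU : ℝ
  /-- the maximum SU transmission power -/
  powerMax : ℝ
  /-- the PU decoding threshold `θ_p` -/
  thetaP : ℝ
  /-- the SU decoding threshold `θ_s` -/
  thetaS : ℝ
  pathGain_pos : 0 < pathGain
  pathGain_lt_one : pathGain < 1
  noise_pos : 0 < noise
  powerPU_pos : 0 < powerPU
  powerMax_pos : 0 < powerMax
  thetaP_pos : 0 < thetaP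
  thetaS_pos : 0 < thetaS

namespace LinkParams

variable (c : LinkParams)

/-- The PU transmit SNR `γ_p = P_p / σ²`. -/
noncomputable def gammaP : ℝ := c.powerPU / c.noise

/-- The maximum SU transmit SNR `γ_max = P_max / σ²`. -/
noncomputable def gammaMax : ℝ := c.powerMax / c.noise

/-- The coefficient
`φ = e^(-θ_p/γ_p) (L-1) λ θ_p θ_s Γ(L-2, θ_s/γ_max) / (γ_p Γ(L-1))`. -/
noncomputable def phi (L : ℕ) : ℝ :=
  Real.exp (-(c.thetaP / c.gammaP)) *
    ((((L : ℝ) - 1) * c.pathGain * c.thetaP * c.thetaS *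
        upperGamma ((L : ℝ) - 2) (c.thetaS / c.gammaMax)) /
      (c.gammaP * Real.Gamma ((L : ℝ) - 1)))

/-- The coefficient `α = e^(-θ_p/γ_p) Γ(L-1, θ_s/γ_max) / Γ(L-1)`. -/
noncomputable def alpha (L : ℕ) : ℝ :=
  Real.exp (-(c.thetaP / c.gammaP)) *
    (upperGamma ((L : ℝ) - 1) (c.thetaS / c.gammaMax) / Real.Gamma ((L : ℝ) - 1))

end LinkParams

/-- The channel shape `h / ‖h‖`. -/
noncomputable def channelShape {L : ℕ} (h : EuclideanSpace ℂ (Fin L)) :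
    EuclideanSpace ℂ (Fin L) :=
  ((‖h‖ : ℂ))⁻¹ • h

/-- The random block-fading channels, with `L` antennas at the SU transmitter, together with a
`B`-bit quantizer of the shape of the SU-to-PU channel. The quantizer may be randomized: its
output is a function of the channel shape and of a seed independent of all channels. Its
quantization error has the law of the sphere-cap model. -/
structure CognitiveLink (L : ℕ) (c : LinkParams) (B : ℕ) {Ω : Type*} [MeasurableSpace Ω]
    (μ : Measure Ω) where
  /-- the primary channel -/
  hp : Ω → ℂ
  /-- the channel from the SU transmitter to the PU receiver -/
  hx : Ω → EuclideanSpace ℂ (Fin L)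
  /-- the secondary channel -/
  hs : Ω → EuclideanSpace ℂ (Fin L)
  /-- the seed of the quantizer -/
  seed : Ω → ℝ
  /-- the quantizer of the channel shape -/
  quantizer : EuclideanSpace ℂ (Fin L) → ℝ → EuclideanSpace ℂ (Fin L)
  measurable_hp : Measurable hp
  measurable_hx : Measurable hx
  measurable_hs : Measurable hs
  measurable_seed : Measurable seed
  measurable_quantizer : Measurable (Function.uncurry quantizer)
  law_hp : μ.map hp = complexGaussian 1
  law_hx : ∀ i, μ.map (fun w => hx w i) = complexGaussian c.pathGain
  law_hs : ∀ i, μ.map (fun w => hs w i) = complexGaussian 1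
  indep_hx : iIndepFun (fun i w => hx w i) μ
  indep_hs : iIndepFun (fun i w => hs w i) μ
  /- The next three fields say that `hp`, `hx`, `hs`, `seed` are mutually independent. -/
  indep_hp_rest : IndepFun hp (fun w => (hx w, hs w, seed w)) μ
  indep_hx_rest : IndepFun hx (fun w => (hs w, seed w)) μ
  indep_hs_seed : IndepFun hs seed μ
  norm_quantizer : ∀ s u, ‖s‖ = 1 → ‖quantizer s u‖ = 1
  cdf_error : ∀ τ : ℝ, 0 ≤ τ → τ ≤ (2 : ℝ) ^ (-((B : ℝ) / ((L : ℝ) - 1))) →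
    μ.real {w | 1 - ‖inner ℂ (quantizer (channelShape (hx w)) (seed w))
        (channelShape (hx w))‖ ^ 2 ≤ τ} = 2 ^ B * τ ^ (L - 1)

namespace CognitiveLink

variable {L : ℕ} {c : LinkParams} {B : ℕ} {Ω : Type*} [MeasurableSpace Ω] {μ : Measure Ω}
  (S : CognitiveLink L c B μ)

/-- The primary channel power `g_p`. -/
noncomputable def gp (w : Ω) : ℝ := ‖S.hp w‖ ^ 2

/-- The normalized power `g_x = ‖h_x‖² / λ` of the SU-to-PU channel. -/
noncomputable def gx (w : Ω) : ℝ := ‖S.hx w‖ ^ 2 / c.pathGain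

/-- The secondary channel power `g_s`. -/
noncomputable def gs (w : Ω) : ℝ := ‖S.hs w‖ ^ 2

/-- The shape `s_x` of the SU-to-PU channel. -/
noncomputable def sx (w : Ω) : EuclideanSpace ℂ (Fin L) := channelShape (S.hx w)

/-- The shape `s_s` of the secondary channel. -/
noncomputable def ss (w : Ω) : EuclideanSpace ℂ (Fin L) := channelShape (S.hs w)

/-- The fed-back quantized channel direction `ŝ_x`. -/
noncomputable def sxHat (w : Ω) : EuclideanSpace ℂ (Fin L) := S.quantizer (S.sx w) (S.seed w)

/-- The quantization error `ε = 1 - |ŝ_x† s_x|²`. -/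
noncomputable def epsilon (w : Ω) : ℝ := 1 - ‖inner ℂ (S.sxHat w) (S.sx w)‖ ^ 2

/-- The unit vector `ŝ_⊥` orthogonal to `ŝ_x` with `s_s = a ŝ_x + b ŝ_⊥`: the normalized
projection of `s_s` onto the orthogonal complement of `ŝ_x`. -/
noncomputable def sPerp (w : Ω) : EuclideanSpace ℂ (Fin L) :=
  channelShape (S.ss w - inner ℂ (S.sxHat w) (S.ss w) • S.sxHat w)

/-- `δ = |s_x† ŝ_⊥|²`. -/
noncomputable def delta (w : Ω) : ℝ := ‖inner ℂ (S.sx w) (S.sPerp w)‖ ^ 2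

/-- The interference margin `ω = σ² (γ_p g_p / θ_p - 1)` of the PU receiver. -/
noncomputable def margin (w : Ω) : ℝ := c.noise * (c.gammaP * S.gp w / c.thetaP - 1)

open Classical in
/-- The unquantized IPC signal `η` without feedforward. -/
noncomputable def eta (w : Ω) : ℝ :=
  if 0 ≤ S.margin w then S.margin w / (c.pathGain * S.gx w * S.epsilon w) else c.powerMax

open Classical in
/-- The unquantized IPC signal with feedforward: `ε` is replaced by `δ`. -/
noncomputable def etaFF (w : Ω) : ℝ :=
  if 0 ≤ S.margin w then S.margin w / (c.pathGain * S.gx w * S.delta w) else c.powerMax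

/-- `p 0 < p 1 < ⋯ < p (2^A - 1)` is the equal-probability IPC codebook of size `N = 2^A`: it
starts at `p 0 = 0` and cuts the range of `η` into `N` cells of probability `1/N`,
given that the PU receiver is not in outage without interference (`γ_p g_p ≥ θ_p`). -/
structure IsIPCCodebook (A : ℕ) (p : ℕ → ℝ) : Prop where
  zero : p 0 = 0
  lt_succ : ∀ n, n + 1 < 2 ^ A → p n < p (n + 1)
  cell : ∀ n, n + 1 < 2 ^ A →
    (cond μ {w | c.thetaP ≤ c.gammaP * S.gp w}).real
      {w | p n < S.eta w ∧ S.eta w ≤ p (n + 1)} = 1 / 2 ^ A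
  last : (cond μ {w | c.thetaP ≤ c.gammaP * S.gp w}).real
      {w | p (2 ^ A - 1) < S.eta w} = 1 / 2 ^ A

/-- The operator `⌊x⌋_P`: the largest element of `{p 0, …, p (2^A - 1)}` that is at most `x`.
The supremum is over a finite set, nonempty for `x ≥ 0` since `p 0 = 0`. -/
noncomputable def codebookFloor (A : ℕ) (p : ℕ → ℝ) (x : ℝ) : ℝ :=
  sSup {q : ℝ | (∃ n, n < 2 ^ A ∧ p n = q) ∧ q ≤ x}

open Classical in
/-- The quantized IPC signal with feedforward. -/
noncomputable def etaFFQuant (A : ℕ) (p : ℕ → ℝ) (w : Ω) : ℝ :=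
  if 0 ≤ S.margin w ∧ S.etaFF w < c.powerMax then codebookFloor A p (S.etaFF w)
  else c.powerMax

/-- Feasible beamformers: orthogonal to `ŝ_x`, of power at most `P`. -/
def feasible (P : ℝ) (w : Ω) : Set (EuclideanSpace ℂ (Fin L)) :=
  {v | inner ℂ v (S.sxHat w) = 0 ∧ ‖v‖ ^ 2 ≤ P}

/-- `f` is the OCB beamformer under the power constraints `P`: in every state it maximizes
`|f† s_s|²` among the feasible beamformers. -/
def IsOCBBeamformer (P : Ω → ℝ) (f : Ω → EuclideanSpace ℂ (Fin L)) : Prop :=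
  ∀ w, f w ∈ S.feasible (P w) w ∧
    IsMaxOn (fun v => ‖inner ℂ v (S.ss w)‖ ^ 2) (S.feasible (P w) w) (f w)

/-- The receive SNR `g_s |f† s_s|² / σ²` of the SU receiver. -/
noncomputable def snrS (f : Ω → EuclideanSpace ℂ (Fin L)) (w : Ω) : ℝ :=
  S.gs w / c.noise * ‖inner ℂ (f w) (S.ss w)‖ ^ 2

/-- The SU outage probability `Pr(SNR_s ≤ θ_s)` under the beamformer `f`. -/
noncomputable def outageS (f : Ω → EuclideanSpace ℂ (Fin L)) : ℝ :=
  μ.real {w | S.snrS f w ≤ c.thetaS}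

end CognitiveLink

/-!
The power `‖h_s - ŝ_x ŝ_x† h_s‖²` seen by the OCB beamformer, `projPower` below, is
`Gamma(L - 1, 1)` distributed, and an outage under a fixed power `P` means `P ≤ q` with
`q = θ_s σ² / projPower`. Hence an outage has three possible causes: `q ≥ P_max`, of probability
`1 - Γ(L-1, θ_s/γ_max) / Γ(L-1)`; the unquantized signal `ω / (λ g_x δ)` is at most `q`; or it
exceeds `q` but lies in the same codebook cell.

Given that it is nonnegative, `ω` is exponential, so its density is bounded by the density at zero,
and the probability of the second cause is at most a constant times `E[g_x δ / projPower]`. Since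
the isotropic vector `h_s` is independent of the other channels, its length and direction decouple,
`E[g_x δ ψ(projPower)] = E[g_x ε] E[ψ(projPower)] / (L - 1)`, and
`E[g_x ε] = (L - 1) 2 ^ (-B / (L - 1))`.

In the third cause `δ` replaces `ε` in the cell probabilities. To first order the probability of a
cell is proportional to its length times the mean of `g_x δ` or `g_x ε`, so it is `1 / (L - 1)`
times the value `2 ^ (-A)` prescribed for `η`. The relative error of this linearization is
controlled by the second moment of `g_x ε`, which is `O(2 ^ (-2 B / (L - 1)))`. Summing over the
disjoint cells of `q` leaves a factor `P(q < P_max)`.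
-/

section Independence

variable {Ω α β γ : Type*} [MeasurableSpace Ω] [MeasurableSpace α] [MeasurableSpace β]
  [MeasurableSpace γ] {μ : Measure Ω}

lemma indepFun_comp_of_indepFun_map {X : Ω → α} {f : α → β} {g : α → γ} (hX : Measurable X)
    (hf : Measurable f) (hg : Measurable g) (h : IndepFun f g (μ.map X)) :
    IndepFun (fun w => f (X w)) (fun w => g (X w)) μ := by
  refine indepFun_iff_measure_inter_preimage_eq_mul.2 fun s t hs ht => ?_
  have hst := h.measure_inter_preimage_eq_mul s t hs ht
  rwa [Measure.map_apply hX ((hf hs).inter (hg ht)), Measure.map_apply hX (hf hs),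
    Measure.map_apply hX (hg ht)] at hst

variable [IsProbabilityMeasure μ]

lemma indepFun_of_measure_inter_preimage_eq_mul {X : Ω → α} {Y : Ω → β}
    (ρ : Set α → ENNReal) (τ : Set β → ENNReal)
    (h : ∀ s t, MeasurableSet s → MeasurableSet t → μ (X ⁻¹' s ∩ Y ⁻¹' t) = ρ s * τ t) :
    IndepFun X Y μ := by
  refine indepFun_iff_measure_inter_preimage_eq_mul.2 fun s t hs ht => ?_
  have hX : μ (X ⁻¹' s) = ρ s * τ univ := by simpa using h s univ hs .univ
  have hY : μ (Y ⁻¹' t) = ρ univ * τ t := by simpa using h univ t .univ ht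
  have hone : ρ univ * τ univ = 1 := by simpa using (h univ univ .univ .univ).symm
  calc μ (X ⁻¹' s ∩ Y ⁻¹' t) = ρ s * τ t * (ρ univ * τ univ) := by rw [h s t hs ht, hone, mul_one]
    _ = μ (X ⁻¹' s) * μ (Y ⁻¹' t) := by rw [hX, hY]; ring

lemma indepFun_prodMk_of_indepFun_prodMk {X : Ω → α} {Y : Ω → β} {Z : Ω → γ}
    (hX : Measurable X) (hY : Measurable Y) (hZ : Measurable Z)
    (hXYZ : IndepFun X (fun w => (Y w, Z w)) μ) (hYZ : IndepFun Y Z μ) :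
    IndepFun Y (fun w => (X w, Z w)) μ := by
  have hXZ : IndepFun X Z μ := hXYZ.comp measurable_id measurable_snd
  have := Measure.isProbabilityMeasure_map (μ := μ) (hX.prodMk hZ).aemeasurable
  rw [indepFun_iff_map_prod_eq_prod_map_map hY.aemeasurable (hX.prodMk hZ).aemeasurable,
    Measure.ext_prod₃_iff]
  intro s t u hs ht hu
  have hsplit : (fun w => (Y w, X w, Z w)) ⁻¹' (s ×ˢ t ×ˢ u) =
      X ⁻¹' t ∩ (fun w => (Y w, Z w)) ⁻¹' (s ×ˢ u) := by
    ext w; simp only [mem_preimage, mem_prod, mem_inter_iff]; tauto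
  have hYZ' : (fun w => (Y w, Z w)) ⁻¹' (s ×ˢ u) = Y ⁻¹' s ∩ Z ⁻¹' u := by ext; simp
  have hXZ' : (fun w => (X w, Z w)) ⁻¹' (t ×ˢ u) = X ⁻¹' t ∩ Z ⁻¹' u := by ext; simp
  rw [Measure.map_apply (by fun_prop) (hs.prod (ht.prod hu)), Measure.prod_prod,
    Measure.map_apply hY hs, Measure.map_apply (by fun_prop) (ht.prod hu), hsplit,
    hXYZ.measure_inter_preimage_eq_mul _ _ ht (hs.prod hu), hYZ', hXZ',
    hYZ.measure_inter_preimage_eq_mul _ _ hs hu, hXZ.measure_inter_preimage_eq_mul _ _ ht hu]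
  ring

lemma lintegral_comp_of_indepFun {X : Ω → α} {Y : Ω → β} (hX : Measurable X) (hY : Measurable Y)
    (h : IndepFun X Y μ) {F : α × β → ENNReal} (hF : Measurable F) :
    ∫⁻ w, F (X w, Y w) ∂μ = ∫⁻ w, ∫⁻ x, F (x, Y w) ∂(μ.map X) ∂μ := by
  have := Measure.isProbabilityMeasure_map (μ := μ) hX.aemeasurable
  have := Measure.isProbabilityMeasure_map (μ := μ) hY.aemeasurable
  rw [← lintegral_map (f := F) (g := fun w => (X w, Y w)) hF (by fun_prop),
    (indepFun_iff_map_prod_eq_prod_map_map hX.aemeasurable hY.aemeasurable).1 h,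
    lintegral_prod_symm _ hF.aemeasurable,
    lintegral_map (f := fun y => ∫⁻ x, F (x, y) ∂(μ.map X)) hF.lintegral_prod_left' hY]

lemma measure_prodMk_mem_of_indepFun {X : Ω → α} {Y : Ω → β} (hX : Measurable X)
    (hY : Measurable Y) (h : IndepFun X Y μ) {s : Set (α × β)} (hs : MeasurableSet s) :
    μ {w | (X w, Y w) ∈ s} = ∫⁻ w, μ.map X {x | (x, Y w) ∈ s} ∂μ := by
  calc μ {w | (X w, Y w) ∈ s} = ∫⁻ w, s.indicator 1 (X w, Y w) ∂μ :=
        (lintegral_indicator_one (hX.prodMk hY hs)).symm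
    _ = ∫⁻ w, ∫⁻ x, s.indicator 1 (x, Y w) ∂(μ.map X) ∂μ :=
        lintegral_comp_of_indepFun hX hY h (measurable_one.indicator hs)
    _ = ∫⁻ w, μ.map X {x | (x, Y w) ∈ s} ∂μ :=
        lintegral_congr fun _ => lintegral_indicator_one (measurable_prodMk_right hs)

end Independence

section GammaLaw

lemma integrableOn_rpow_mul_exp_neg_Ioi (s : ℝ) {x : ℝ} (hx : 0 < x) :
    IntegrableOn (fun t => t ^ (s - 1) * Real.exp (-t)) (Ioi x) := by
  refine integrable_of_isBigO_exp_neg one_half_pos ?_ ?_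
  · refine ContinuousOn.mul (fun t ht => ?_) (by fun_prop)
    exact (Real.continuousAt_rpow_const _ _ (.inl (hx.trans_le ht).ne')).continuousWithinAt
  · simpa only [mul_comm] using (Real.Gamma_integrand_isLittleO (s - 1)).isBigO

lemma upperGamma_nonneg (s : ℝ) {x : ℝ} (hx : 0 ≤ x) : 0 ≤ upperGamma s x :=
  setIntegral_nonneg measurableSet_Ioi fun _ ht =>
    mul_nonneg (Real.rpow_nonneg (hx.trans (le_of_lt ht)) _) (Real.exp_pos _).le

lemma gammaMeasure_one_eq_withDensity (a : ℝ) :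
    gammaMeasure a 1 = (volume.restrict (Ioi 0)).withDensity
      fun t => ENNReal.ofReal (t ^ (a - 1) * Real.exp (-t) / Real.Gamma a) := by
  rw [gammaMeasure, ← withDensity_indicator measurableSet_Ioi]
  refine withDensity_congr_ae ?_
  filter_upwards [compl_mem_ae_iff.2 (measure_singleton (0 : ℝ))] with t (ht : t ≠ 0)
  rcases ht.lt_or_gt with h | h
  · rw [gammaPDF_of_neg h, indicator_of_notMem (by simpa using h.le)]
  · rw [gammaPDF_of_nonneg h.le, indicator_of_mem (mem_Ioi.2 h)]
    simp only [Real.one_rpow, one_mul]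
    congr 1
    ring

lemma lintegral_gammaMeasure_one (a : ℝ) {f : ℝ → ENNReal} (hf : Measurable f) :
    ∫⁻ t, f t ∂gammaMeasure a 1 =
      ∫⁻ t in Ioi 0, ENNReal.ofReal (t ^ (a - 1) * Real.exp (-t) / Real.Gamma a) * f t := by
  rw [gammaMeasure_one_eq_withDensity, lintegral_withDensity_eq_lintegral_mul _ (by fun_prop) hf]
  rfl

lemma ae_pos_gammaMeasure_one (a : ℝ) : ∀ᵐ t ∂gammaMeasure a 1, 0 < t := by
  rw [gammaMeasure_one_eq_withDensity]
  exact (withDensity_absolutelyContinuous _ _).ae_le (ae_restrict_mem measurableSet_Ioi)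

lemma setLIntegral_rpow_gammaMeasure {a p x : ℝ} (ha : 0 < a) (hx : 0 ≤ x)
    (hint : IntegrableOn (fun t => t ^ (a + p - 1) * Real.exp (-t)) (Ioi x)) :
    ∫⁻ t in Ioi x, ENNReal.ofReal (t ^ p) ∂gammaMeasure a 1 =
      ENNReal.ofReal (upperGamma (a + p) x / Real.Gamma a) := by
  have hΓ := Real.Gamma_pos_of_pos ha
  rw [gammaMeasure_one_eq_withDensity, setLIntegral_withDensity_eq_setLIntegral_mul _ (by fun_prop)
      (by fun_prop) measurableSet_Ioi, Measure.restrict_restrict measurableSet_Ioi,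
    inter_eq_left.2 (Ioi_subset_Ioi hx), upperGamma, ← integral_div,
    ofReal_integral_eq_lintegral_ofReal (hint.div_const _)]
  · refine setLIntegral_congr_fun measurableSet_Ioi fun t (ht : x < t) => ?_
    have ht0 : 0 < t := hx.trans_lt ht
    rw [Pi.mul_apply, ← ENNReal.ofReal_mul (by positivity), add_sub_right_comm,
      Real.rpow_add ht0]
    congr 1
    ring
  · refine (ae_restrict_mem measurableSet_Ioi).mono fun t (ht : x < t) => ?_
    have ht0 : 0 < t := hx.trans_lt ht
    dsimp only [Pi.zero_apply]
    positivity

lemma gammaMeasure_Ioi {a x : ℝ} (ha : 0 < a) (hx : 0 < x) :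
    gammaMeasure a 1 (Ioi x) = ENNReal.ofReal (upperGamma a x / Real.Gamma a) := by
  simpa using setLIntegral_rpow_gammaMeasure (p := 0) ha hx.le
    (by simpa using integrableOn_rpow_mul_exp_neg_Ioi a hx)

lemma gammaMeasure_one_one_Ioi {x : ℝ} (hx : 0 < x) :
    gammaMeasure 1 1 (Ioi x) = ENNReal.ofReal (Real.exp (-x)) := by
  simp only [gammaMeasure_Ioi one_pos hx, upperGamma, sub_self, Real.rpow_zero, one_mul,
    Real.Gamma_one, div_one, integral_exp_neg_Ioi]

lemma gammaMeasure_one_one_Ici {x : ℝ} (hx : 0 < x) :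
    gammaMeasure 1 1 (Ici x) = ENNReal.ofReal (Real.exp (-x)) := by
  have hnull : gammaMeasure 1 1 {x} = 0 :=
    withDensity_absolutelyContinuous volume _ (measure_singleton x)
  rw [← gammaMeasure_one_one_Ioi hx, measure_congr (Ioi_ae_eq_Ici' hnull)]

lemma gammaMeasure_one_one_Icc {x y : ℝ} (hx : 0 < x) (hxy : x ≤ y) :
    gammaMeasure 1 1 (Icc x y) = ENNReal.ofReal (Real.exp (-x) - Real.exp (-y)) := by
  have hy := gammaMeasure_one_one_Ioi (hx.trans_le hxy)
  rw [← Ici_sdiff_Ioi, measure_sdiff (Ioi_subset_Ici hxy) measurableSet_Ioi.nullMeasurableSet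
    (hy ▸ ENNReal.ofReal_ne_top), gammaMeasure_one_one_Ici hx, hy,
    ENNReal.ofReal_sub _ (Real.exp_pos _).le]

lemma exp_neg_sub_exp_neg_le {s t : ℝ} (hs : 0 ≤ s) (hst : s ≤ t) :
    Real.exp (-s) - Real.exp (-t) ≤ t - s := by
  have hdiff : 1 - Real.exp (-(t - s)) ≤ t - s := by linarith [Real.add_one_le_exp (-(t - s))]
  calc Real.exp (-s) - Real.exp (-t) = Real.exp (-s) * (1 - Real.exp (-(t - s))) := by
        rw [mul_sub, ← Real.exp_add]; ring_nf
    _ ≤ 1 * (t - s) := mul_le_mul (Real.exp_le_one_iff.2 (by linarith)) hdiff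
        (sub_nonneg.2 (Real.exp_le_one_iff.2 (by linarith))) zero_le_one
    _ = t - s := one_mul _

lemma sub_sub_sq_le_exp_neg_sub_exp_neg {s t : ℝ} (hs : 0 ≤ s) (hst : s ≤ t) :
    t - s - t ^ 2 ≤ Real.exp (-s) - Real.exp (-t) := by
  have hs' : 1 - s ≤ Real.exp (-s) := by linarith [Real.add_one_le_exp (-s)]
  have ht : Real.exp (-t) ≤ (1 + t)⁻¹ := by
    rw [Real.exp_neg]
    exact inv_anti₀ (by linarith) (by linarith [Real.add_one_le_exp t])
  have hinv : (1 + t)⁻¹ ≤ 1 - t + t ^ 2 := by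
    rw [inv_le_iff_one_le_mul₀ (by linarith)]
    nlinarith [pow_nonneg (hs.trans hst) 3]
  linarith

lemma lintegral_rpow_gammaMeasure {a p : ℝ} (ha : 0 < a) (hp : 0 < a + p) :
    ∫⁻ t, ENNReal.ofReal (t ^ p) ∂gammaMeasure a 1 =
      ENNReal.ofReal (Real.Gamma (a + p) / Real.Gamma a) := by
  have hint : IntegrableOn (fun t => t ^ (a + p - 1) * Real.exp (-t)) (Ioi 0) := by
    simpa only [mul_comm] using Real.GammaIntegral_convergent hp
  have hΓ : upperGamma (a + p) 0 = Real.Gamma (a + p) := by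
    simp only [upperGamma, Real.Gamma_eq_integral hp, mul_comm]
  rw [← hΓ, ← setLIntegral_rpow_gammaMeasure ha le_rfl hint,
    Measure.restrict_eq_self_of_ae_mem (s := Ioi 0) (ae_pos_gammaMeasure_one a)]

end GammaLaw

section IsoGaussian

/-- The density of `isoGaussian`, with respect to the volume of the inner product space `V`. -/
noncomputable def isoGaussianDensity (V : Type*) [NormedAddCommGroup V] [InnerProductSpace ℝ V]
    (v : ℝ) (x : V) : ℝ :=
  (Real.pi * v) ^ (-(Module.finrank ℝ V / 2 : ℝ)) * Real.exp (-(‖x‖ ^ 2 / v))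

/-- The centred isotropic Gaussian law on `V`. Its variance is `v / 2` in each real direction, so
that `CN(0, v)` is the case `V = ℂ`. -/
noncomputable def isoGaussian (V : Type*) [NormedAddCommGroup V] [InnerProductSpace ℝ V]
    [FiniteDimensional ℝ V] [MeasurableSpace V] [BorelSpace V] (v : ℝ) : Measure V :=
  volume.withDensity fun x => ENNReal.ofReal (isoGaussianDensity V v x)

variable {V : Type*} [NormedAddCommGroup V] [InnerProductSpace ℝ V]

lemma continuous_isoGaussianDensity (v : ℝ) : Continuous (isoGaussianDensity V v) := by
  unfold isoGaussianDensity; fun_prop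

lemma isoGaussianDensity_nonneg {v : ℝ} (hv : 0 < v) (x : V) : 0 ≤ isoGaussianDensity V v x := by
  unfold isoGaussianDensity; positivity

variable [FiniteDimensional ℝ V] [MeasurableSpace V] [BorelSpace V]

lemma integral_isoGaussianDensity_mul_cexp {v : ℝ} (hv : 0 < v) (t : V) :
    ∫ x, (isoGaussianDensity V v x : ℂ) * Complex.exp (Complex.I * (inner ℝ t x : ℝ)) =
      Complex.exp (-(v * ‖t‖ ^ 2 / 4 : ℝ)) := by
  have hgauss := GaussianFourier.integral_cexp_neg_mul_sq_norm_add (V := V)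
    (b := ((1 / v : ℝ) : ℂ)) (by simpa using hv) Complex.I t
  have hintegrand (x : V) :
      (isoGaussianDensity V v x : ℂ) * Complex.exp (Complex.I * (inner ℝ t x : ℝ)) =
        (((Real.pi * v) ^ (-(Module.finrank ℝ V / 2 : ℝ)) : ℝ) : ℂ) *
        Complex.exp (-((1 / v : ℝ) : ℂ) * ‖x‖ ^ 2 + Complex.I * (inner ℝ t x : ℝ)) := by
    rw [isoGaussianDensity, Complex.exp_add, ← mul_assoc]
    congr 1
    push_cast
    congr 2
    ring
  have hfactor : ((Real.pi : ℂ) / ((1 / v : ℝ) : ℂ)) ^ ((Module.finrank ℝ V : ℂ) / 2) =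
      (((Real.pi * v) ^ (Module.finrank ℝ V / 2 : ℝ) : ℝ) : ℂ) := by
    rw [Complex.ofReal_cpow (by positivity)]
    push_cast
    congr 1
    field_simp
  simp_rw [hintegrand]
  rw [integral_const_mul, hgauss, ← mul_assoc, hfactor, ← Complex.ofReal_mul,
    ← Real.rpow_add (by positivity)]
  simp only [neg_add_cancel, Real.rpow_zero, Complex.ofReal_one, one_mul, Complex.I_sq]
  congr 1
  have : (v : ℂ) ≠ 0 := by exact_mod_cast hv.ne'
  push_cast
  field_simp

lemma isProbabilityMeasure_isoGaussian {v : ℝ} (hv : 0 < v) :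
    IsProbabilityMeasure (isoGaussian V v) := by
  have h := integral_isoGaussianDensity_mul_cexp hv (0 : V)
  simp only [inner_zero_left, Complex.ofReal_zero, mul_zero, Complex.exp_zero, mul_one, norm_zero,
    ne_eq, OfNat.ofNat_ne_zero, not_false_eq_true, zero_pow, zero_div, neg_zero] at h
  rw [integral_complex_ofReal] at h
  have h1 : ∫ x, isoGaussianDensity V v x = 1 := by exact_mod_cast h
  have hi : Integrable (isoGaussianDensity V v) := by
    by_contra hc
    rw [integral_undef hc] at h1
    exact zero_ne_one h1
  constructor
  rw [isoGaussian, withDensity_apply _ MeasurableSet.univ, setLIntegral_univ,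
    ← ofReal_integral_eq_lintegral_ofReal hi
      (Filter.Eventually.of_forall (isoGaussianDensity_nonneg hv)), h1, ENNReal.ofReal_one]

lemma charFun_isoGaussian {v : ℝ} (hv : 0 < v) (t : V) :
    charFun (isoGaussian V v) t = Complex.exp (-(v * ‖t‖ ^ 2 / 4 : ℝ)) := by
  rw [← integral_isoGaussianDensity_mul_cexp hv t, charFun_apply, isoGaussian,
    integral_withDensity_eq_integral_toReal_smul
      (continuous_isoGaussianDensity v).measurable.ennreal_ofReal (by simp)]
  congr 1
  ext x
  rw [ENNReal.toReal_ofReal (isoGaussianDensity_nonneg hv x), real_inner_comm, Complex.real_smul,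
    mul_comm Complex.I]

lemma lintegral_isoGaussian (v : ℝ) {F : V → ENNReal} (hF : Measurable F) :
    ∫⁻ x, F x ∂(isoGaussian V v) =
      ∫⁻ x, ENNReal.ofReal (isoGaussianDensity V v x) * F x := by
  rw [isoGaussian, lintegral_withDensity_eq_lintegral_mul _
    (continuous_isoGaussianDensity v).measurable.ennreal_ofReal hF]
  rfl

lemma measurePreserving_isoGaussian_of_adjoint {W : Type*} [NormedAddCommGroup W]
    [InnerProductSpace ℝ W] [FiniteDimensional ℝ W] [MeasurableSpace W] [BorelSpace W]
    {f : V → W} (hf : Measurable f) (g : W → V) (hg : ∀ t, ‖g t‖ = ‖t‖)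
    (hfg : ∀ x t, inner ℝ (f x) t = inner ℝ x (g t)) {v : ℝ} (hv : 0 < v) :
    MeasurePreserving f (isoGaussian V v) (isoGaussian W v) := by
  refine ⟨hf, ?_⟩
  have := isProbabilityMeasure_isoGaussian (V := V) hv
  have := isProbabilityMeasure_isoGaussian (V := W) hv
  have := Measure.isProbabilityMeasure_map (μ := isoGaussian V v) hf.aemeasurable
  refine Measure.ext_of_charFun ?_
  ext t
  rw [charFun_isoGaussian hv, charFun_apply, integral_map hf.aemeasurable (by fun_prop)]
  simp_rw [hfg]
  rw [← charFun_apply, charFun_isoGaussian hv, hg]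

lemma isoGaussian_null_of_volume_null {v : ℝ} {s : Set V} (hs : volume s = 0) :
    isoGaussian V v s = 0 :=
  withDensity_absolutelyContinuous _ _ hs

lemma lintegral_norm_mul_direction [Nontrivial V] (μ : Measure V) [μ.IsAddHaarMeasure]
    {f : ℝ → ENNReal} (hf : Measurable f) {g : V → ENNReal} (hg : Measurable g) :
    ∫⁻ x, f ‖x‖ * g (‖x‖⁻¹ • x) ∂μ = (∫⁻ y, g y ∂μ.toSphere) *
      ∫⁻ r in Ioi 0, ENNReal.ofReal (r ^ (Module.finrank ℝ V - 1)) * f r := by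
  have hpolar := μ.measurePreserving_homeomorphUnitSphereProd.lintegral_comp_emb
    (Homeomorph.measurableEmbedding _)
    (fun y : Metric.sphere (0 : V) 1 × Ioi (0 : ℝ) => g y.1 * f y.2)
  rw [lintegral_prod_mul (f := fun y : Metric.sphere (0 : V) 1 => g y)
    (g := fun r : Ioi (0 : ℝ) => f r) (by fun_prop) (by fun_prop)] at hpolar
  have hradial : ∫⁻ r, f r ∂Measure.volumeIoiPow (Module.finrank ℝ V - 1) =
      ∫⁻ r in Ioi 0, ENNReal.ofReal (r ^ (Module.finrank ℝ V - 1)) * f r := by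
    rw [Measure.volumeIoiPow, lintegral_withDensity_eq_lintegral_mul _ (by fun_prop) (by fun_prop)]
    exact lintegral_subtype_comap measurableSet_Ioi
      (fun r => ENNReal.ofReal (r ^ (Module.finrank ℝ V - 1)) * f r)
  have hpunctured : ∫⁻ x, f ‖x‖ * g (‖x‖⁻¹ • x) ∂μ =
      ∫⁻ x : ({0}ᶜ : Set V), f ‖(x : V)‖ * g (‖(x : V)‖⁻¹ • (x : V)) ∂μ.comap Subtype.val := by
    rw [lintegral_subtype_comap (measurableSet_singleton 0).compl
      (fun x => f ‖x‖ * g (‖x‖⁻¹ • x)), restrict_compl_singleton]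
  rw [← hradial, ← hpolar, hpunctured]
  refine lintegral_congr fun x => ?_
  rw [mul_comm, homeomorphUnitSphereProd_apply_fst_coe, homeomorphUnitSphereProd_apply_snd_coe]

lemma lintegral_comp_sq_div {n : ℕ} (hn : n ≠ 0) {v : ℝ} (hv : 0 < v) (f : ℝ → ENNReal) :
    ∫⁻ r in Ioi 0, ENNReal.ofReal (r ^ (n - 1)) * f (r ^ 2 / v) =
      ENNReal.ofReal (v ^ (n / 2 : ℝ) / 2) *
        ∫⁻ t in Ioi 0, ENNReal.ofReal (t ^ (n / 2 - 1 : ℝ)) * f t := by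
  have himage : (fun r : ℝ => r ^ 2 / v) '' Ioi 0 = Ioi 0 := by
    refine Subset.antisymm (image_subset_iff.2 fun r (hr : 0 < r) => ?_) fun t (ht : 0 < t) => 
      ⟨√(v * t), Real.sqrt_pos.2 (mul_pos hv ht), ?_⟩
    · exact div_pos (pow_pos hr 2) hv
    dsimp only
    rw [Real.sq_sqrt (by positivity), mul_div_cancel_left₀ _ hv.ne']
  have hderiv : ∀ r ∈ Ioi (0 : ℝ),
      HasDerivWithinAt (fun r : ℝ => r ^ 2 / v) (2 * r / v) (Ioi 0) r := fun r _ => by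
    simpa using ((hasDerivAt_pow 2 r).div_const v).hasDerivWithinAt (s := Ioi 0)
  have hinj : InjOn (fun r : ℝ => r ^ 2 / v) (Ioi 0) := fun a ha b hb hab =>
    (pow_left_inj₀ (le_of_lt ha) (le_of_lt hb) two_ne_zero).1
      ((div_left_inj' (a := a ^ 2) (b := b ^ 2) hv.ne').1 hab)
  have hsubst := lintegral_image_eq_lintegral_abs_deriv_mul measurableSet_Ioi hderiv hinj
    (fun t => ENNReal.ofReal (t ^ (n / 2 - 1 : ℝ)) * f t)
  rw [himage] at hsubst
  rw [hsubst, ← lintegral_const_mul' _ _ ENNReal.ofReal_ne_top]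
  refine setLIntegral_congr_fun measurableSet_Ioi fun r (hr : 0 < r) => ?_
  have hpow : r ^ (n - 1) = v ^ (n / 2 : ℝ) / 2 * |2 * r / v| * (r ^ 2 / v) ^ (n / 2 - 1 : ℝ) := by
    rw [abs_of_pos (by positivity), Real.div_rpow (by positivity) hv.le, ← Real.rpow_natCast r 2,
      ← Real.rpow_mul hr.le, Real.rpow_sub hv, Real.rpow_one, ← Real.rpow_natCast,
      Nat.cast_pred (Nat.pos_of_ne_zero hn), Nat.cast_two, mul_sub, mul_one,
      mul_div_cancel₀ _ two_ne_zero, Real.rpow_sub hr, Real.rpow_sub hr, Real.rpow_one,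
      Real.rpow_two]
    field_simp
  rw [hpow, ENNReal.ofReal_mul (by positivity), ENNReal.ofReal_mul (by positivity)]
  ring

lemma lintegral_isoGaussian_norm_mul_direction [Nontrivial V] {v : ℝ} {f : ℝ → ENNReal}
    (hf : Measurable f) {g : V → ENNReal} (hg : Measurable g) :
    ∫⁻ x, f ‖x‖ * g (‖x‖⁻¹ • x) ∂isoGaussian V v =
      (∫⁻ y, g y ∂(volume : Measure V).toSphere) *
        ∫⁻ r in Ioi 0, ENNReal.ofReal (r ^ (Module.finrank ℝ V - 1)) *
          (ENNReal.ofReal ((Real.pi * v) ^ (-(Module.finrank ℝ V / 2 : ℝ)) *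
            Real.exp (-(r ^ 2 / v))) * f r) := by
  rw [lintegral_isoGaussian _ (by fun_prop), ← lintegral_norm_mul_direction _ (by fun_prop) hg]
  simp only [isoGaussianDensity, mul_assoc]

lemma indepFun_norm_direction_isoGaussian [Nontrivial V] {v : ℝ} (hv : 0 < v) :
    IndepFun (fun x : V => ‖x‖) (fun x => ‖x‖⁻¹ • x) (isoGaussian V v) := by
  have := isProbabilityMeasure_isoGaussian (V := V) hv
  refine indepFun_of_measure_inter_preimage_eq_mul
    (fun s => ∫⁻ r in Ioi 0, ENNReal.ofReal (r ^ (Module.finrank ℝ V - 1)) *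
      (ENNReal.ofReal ((Real.pi * v) ^ (-(Module.finrank ℝ V / 2 : ℝ)) *
        Real.exp (-(r ^ 2 / v))) * s.indicator 1 r))
    (fun t => ∫⁻ y, t.indicator 1 (y : V) ∂(volume : Measure V).toSphere) fun s t hs ht => ?_
  have hdir : Measurable fun x : V => ‖x‖⁻¹ • x := by fun_prop
  have h := lintegral_isoGaussian_norm_mul_direction (V := V) (v := v)
    (f := s.indicator 1) (g := t.indicator 1) (measurable_one.indicator hs)
    (measurable_one.indicator ht)
  have hmeas : MeasurableSet ((fun x : V => ‖x‖) ⁻¹' s ∩ (fun x => ‖x‖⁻¹ • x) ⁻¹' t) :=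
    (measurable_norm hs).inter (hdir ht)
  rw [← lintegral_indicator_one hmeas, inter_indicator_one]
  exact h.trans (mul_comm _ _)

lemma map_norm_sq_div_isoGaussian [Nontrivial V] {v : ℝ} (hv : 0 < v) :
    (isoGaussian V v).map (fun x => ‖x‖ ^ 2 / v) = gammaMeasure (Module.finrank ℝ V / 2) 1 := by
  set a : ℝ := Module.finrank ℝ V / 2
  have hfin : Module.finrank ℝ V ≠ 0 := Module.finrank_pos.ne'
  have ha0 : 0 < a := by positivity
  have := isProbabilityMeasure_isoGaussian (V := V) hv
  have := isProbabilityMeasure_gammaMeasure ha0 one_pos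
  obtain ⟨κ, hκ⟩ : ∃ κ, ∀ f : ℝ → ENNReal, Measurable f →
      ∫⁻ x, f (‖x‖ ^ 2 / v) ∂isoGaussian V v = κ * ∫⁻ t, f t ∂gammaMeasure a 1 := by
    have hΓ := Real.Gamma_pos_of_pos ha0
    refine ⟨(volume : Measure V).toSphere univ * (ENNReal.ofReal (v ^ a / 2) *
      ENNReal.ofReal ((Real.pi * v) ^ (-a) * Real.Gamma a)), fun f hf => ?_⟩
    have hpolar := lintegral_isoGaussian_norm_mul_direction (V := V) (v := v)
      (f := fun r => f (r ^ 2 / v)) (by fun_prop) (g := fun _ => 1) measurable_const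
    have hsubst := lintegral_comp_sq_div hfin hv
      (fun t => ENNReal.ofReal ((Real.pi * v) ^ (-a) * Real.exp (-t)) * f t)
    have hgamma : ∫⁻ t in Ioi 0, ENNReal.ofReal (t ^ (a - 1)) *
        (ENNReal.ofReal ((Real.pi * v) ^ (-a) * Real.exp (-t)) * f t) =
        ENNReal.ofReal ((Real.pi * v) ^ (-a) * Real.Gamma a) * ∫⁻ t, f t ∂gammaMeasure a 1 := by
      rw [lintegral_gammaMeasure_one a hf, ← lintegral_const_mul' _ _ ENNReal.ofReal_ne_top]
      refine setLIntegral_congr_fun measurableSet_Ioi fun t (ht : 0 < t) => ?_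
      rw [← mul_assoc, ← mul_assoc, ← ENNReal.ofReal_mul (by positivity),
        ← ENNReal.ofReal_mul (by positivity)]
      congr 2
      field_simp
    simp only [mul_one, lintegral_one] at hpolar
    exact (hpolar.trans (congrArg _ (hsubst.trans (congrArg _ hgamma)))).trans (by ring)
  have hone : κ = 1 := by simpa using (hκ (fun _ => 1) measurable_const).symm
  refine Measure.ext fun s hs => ?_
  rw [← lintegral_indicator_one hs, ← lintegral_indicator_one hs,
    lintegral_map (measurable_one.indicator hs) (by fun_prop),
    hκ _ (measurable_one.indicator hs), hone, one_mul]

end IsoGaussian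

section ComplexGaussian

lemma charFun_complexGaussian (v : NNReal) (t : ℂ) :
    charFun (complexGaussian v) t = Complex.exp (-(v * ‖t‖ ^ 2 / 4 : ℝ)) := by
  have hsplit (x : ℝ × ℝ) :
      Complex.exp ((inner ℝ (Complex.measurableEquivRealProd.symm x) t : ℝ) * Complex.I) =
        Complex.exp ((inner ℝ x.1 t.re : ℝ) * Complex.I) *
          Complex.exp ((inner ℝ x.2 t.im : ℝ) * Complex.I) := by
    rw [← Complex.exp_add]
    congr 1
    simp [Complex.inner, Complex.measurableEquivRealProd]
    ring
  rw [charFun_apply, complexGaussian, integral_map (by fun_prop) (by fun_prop)]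
  simp_rw [hsplit]
  rw [integral_prod_mul (fun x : ℝ => Complex.exp ((inner ℝ x t.re : ℝ) * Complex.I))
    (fun x : ℝ => Complex.exp ((inner ℝ x t.im : ℝ) * Complex.I)), ← charFun_apply,
    ← charFun_apply, charFun_gaussianReal, charFun_gaussianReal, ← Complex.exp_add,
    ← Complex.normSq_eq_norm_sq, Complex.normSq_apply]
  congr 1
  push_cast
  ring

instance (v : NNReal) : IsProbabilityMeasure (complexGaussian v) :=
  Measure.isProbabilityMeasure_map (by fun_prop)

lemma complexGaussian_eq_isoGaussian {v : NNReal} (hv : 0 < v) :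
    complexGaussian v = isoGaussian ℂ v := by
  have := isProbabilityMeasure_isoGaussian (V := ℂ) (v := v) hv
  refine Measure.ext_of_charFun (funext fun t => ?_)
  rw [charFun_complexGaussian, charFun_isoGaussian (by exact_mod_cast hv)]

variable {ι : Type*} [Fintype ι]

lemma map_pi_complexGaussian {v : NNReal} (hv : 0 < v) :
    (Measure.pi fun _ : ι => complexGaussian v).map (WithLp.toLp 2) =
      isoGaussian (EuclideanSpace ℂ ι) v := by
  have := isProbabilityMeasure_isoGaussian (V := EuclideanSpace ℂ ι) (v := v) hv
  have := Measure.isProbabilityMeasure_map (μ := Measure.pi fun _ : ι => complexGaussian v)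
    (f := WithLp.toLp 2) (by fun_prop)
  refine Measure.ext_of_charFun (funext fun t => ?_)
  rw [charFun_pi, charFun_isoGaussian (by exact_mod_cast hv), EuclideanSpace.norm_sq_eq]
  simp_rw [charFun_complexGaussian]
  rw [← Complex.exp_sum]
  congr 1
  push_cast
  rw [Finset.mul_sum, Finset.sum_div, Finset.sum_neg_distrib]

lemma map_eq_isoGaussian_of_iIndepFun {v : NNReal} (hv : 0 < v) {Ω : Type*} [MeasurableSpace Ω]
    {μ : Measure Ω} [IsProbabilityMeasure μ] {h : Ω → EuclideanSpace ℂ ι} (hm : Measurable h)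
    (hlaw : ∀ i, μ.map (fun w => h w i) = complexGaussian v)
    (hindep : iIndepFun (fun i w => h w i) μ) : μ.map h = isoGaussian (EuclideanSpace ℂ ι) v := by
  have hpi := (iIndepFun_iff_map_fun_eq_pi_map (fun i => by fun_prop)).1 hindep
  simp_rw [hlaw] at hpi
  rw [← map_pi_complexGaussian hv, ← hpi, Measure.map_map (by fun_prop) (by fun_prop)]
  rfl

lemma finrank_real_euclideanSpace_complex (k : ℕ) :
    Module.finrank ℝ (EuclideanSpace ℂ (Fin k)) = 2 * k := by
  rw [finrank_real_of_complex, finrank_euclideanSpace_fin]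

lemma map_norm_sq_div_isoGaussian_euclideanSpace {n : ℕ} (hn : n ≠ 0) {v : ℝ} (hv : 0 < v) :
    (isoGaussian (EuclideanSpace ℂ (Fin n)) v).map (fun x => ‖x‖ ^ 2 / v) = gammaMeasure n 1 := by
  have : Nonempty (Fin n) := ⟨⟨0, Nat.pos_of_ne_zero hn⟩⟩
  rw [map_norm_sq_div_isoGaussian hv, finrank_real_euclideanSpace_complex]
  push_cast
  rw [mul_div_cancel_left₀ _ two_ne_zero]

lemma euclideanSpace_real_inner_eq_re_inner (x y : EuclideanSpace ℂ ι) :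
    inner ℝ x y = (inner ℂ x y).re := by
  simp [PiLp.inner_apply, Complex.inner]

lemma measurePreserving_adjoint_isoGaussian {κ : Type*} [Fintype κ]
    (U : EuclideanSpace ℂ κ →ₗᵢ[ℂ] EuclideanSpace ℂ ι) {v : ℝ} (hv : 0 < v) :
    MeasurePreserving (ContinuousLinearMap.adjoint U.toContinuousLinearMap)
      (isoGaussian (EuclideanSpace ℂ ι) v) (isoGaussian (EuclideanSpace ℂ κ) v) := by
  refine measurePreserving_isoGaussian_of_adjoint (ContinuousLinearMap.continuous _).measurable U
    U.norm_map (fun x t => ?_) hv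
  rw [euclideanSpace_real_inner_eq_re_inner, euclideanSpace_real_inner_eq_re_inner,
    ContinuousLinearMap.adjoint_inner_left]
  rfl

lemma lintegral_isoGaussian_comp_isometryEquiv
    (U : EuclideanSpace ℂ ι ≃ₗᵢ[ℂ] EuclideanSpace ℂ ι) {v : ℝ} (hv : 0 < v)
    {f : EuclideanSpace ℂ ι → ENNReal} (hf : Measurable f) :
    ∫⁻ x, f (U x) ∂isoGaussian (EuclideanSpace ℂ ι) v =
      ∫⁻ x, f x ∂isoGaussian (EuclideanSpace ℂ ι) v := by
  have hU : MeasurePreserving U (isoGaussian (EuclideanSpace ℂ ι) v)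
      (isoGaussian (EuclideanSpace ℂ ι) v) :=
    measurePreserving_isoGaussian_of_adjoint U.continuous.measurable U.symm U.symm.norm_map
      (fun x t => by
        rw [euclideanSpace_real_inner_eq_re_inner, euclideanSpace_real_inner_eq_re_inner,
          ← U.inner_map_map x, U.apply_symm_apply]) hv
  exact hU.lintegral_comp hf

lemma ae_ne_zero_isoGaussian [Nonempty ι] (v : ℝ) :
    ∀ᵐ y ∂isoGaussian (EuclideanSpace ℂ ι) v, y ≠ 0 :=
  isoGaussian_null_of_volume_null (by simp [measure_singleton])

lemma lintegral_norm_inner_orthonormalBasis_sq_div_isoGaussian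
    (b : OrthonormalBasis ι ℂ (EuclideanSpace ℂ ι)) (i : ι) {v : ℝ} (hv : 0 < v)
    {φ : ℝ → ENNReal} (hφ : Measurable φ) :
    ∫⁻ y, ENNReal.ofReal (‖inner ℂ (b i) y‖ ^ 2 / ‖y‖ ^ 2) * φ ‖y‖
        ∂isoGaussian (EuclideanSpace ℂ ι) v =
      (Fintype.card ι : ENNReal)⁻¹ * ∫⁻ y, φ ‖y‖ ∂isoGaussian (EuclideanSpace ℂ ι) v := by
  classical
  have : Nonempty ι := ⟨i⟩
  let mean (j : ι) : ENNReal := ∫⁻ y, ENNReal.ofReal (‖inner ℂ (b j) y‖ ^ 2 / ‖y‖ ^ 2) * φ ‖y‖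
    ∂isoGaussian (EuclideanSpace ℂ ι) v
  have hmean (j : ι) : mean j = mean i := by
    let U := b.equiv b (Equiv.swap i j)
    refine Eq.trans (lintegral_congr fun y => ?_) (lintegral_isoGaussian_comp_isometryEquiv U hv
      (f := fun y => ENNReal.ofReal (‖inner ℂ (b i) y‖ ^ 2 / ‖y‖ ^ 2) * φ ‖y‖) (by fun_prop))
    have hUb : b i = U (b j) := by simp [U]
    rw [hUb, U.inner_map_map, U.norm_map]
  have hsum : ∑ j, mean j = ∫⁻ y, φ ‖y‖ ∂isoGaussian (EuclideanSpace ℂ ι) v := by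
    rw [← lintegral_finsetSum _ (by fun_prop)]
    refine lintegral_congr_ae ((ae_ne_zero_isoGaussian v).mono fun y hy => ?_)
    dsimp only
    rw [← Finset.sum_mul, ← ENNReal.ofReal_sum_of_nonneg (fun _ _ => by positivity),
      ← Finset.sum_div, b.sum_sq_norm_inner_right, div_self (by simpa using hy),
      ENNReal.ofReal_one, one_mul]
  have hcard : (Fintype.card ι : ENNReal) ≠ 0 := by simp
  simp only [hmean, Finset.sum_const, Finset.card_univ, nsmul_eq_mul] at hsum
  rw [← hsum, ← mul_assoc, ENNReal.inv_mul_cancel hcard (ENNReal.natCast_ne_top _), one_mul]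

lemma exists_orthonormalBasis_apply_eq (i : ι) {s : EuclideanSpace ℂ ι} (hs : ‖s‖ = 1) :
    ∃ b : OrthonormalBasis ι ℂ (EuclideanSpace ℂ ι), b i = s := by
  have hunit : Orthonormal ℂ (({i} : Set ι).domRestrict fun _ => s) :=
    ⟨fun _ => hs, fun j k hjk => (hjk (Subsingleton.elim j k)).elim⟩
  obtain ⟨b, hb⟩ := hunit.exists_orthonormalBasis_extension_of_card_eq finrank_euclideanSpace
  exact ⟨b, hb i rfl⟩

lemma lintegral_norm_inner_sq_div_isoGaussian (s : EuclideanSpace ℂ ι) {v : ℝ} (hv : 0 < v)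
    {φ : ℝ → ENNReal} (hφ : Measurable φ) :
    ∫⁻ y, ENNReal.ofReal (‖inner ℂ s y‖ ^ 2 / ‖y‖ ^ 2) * φ ‖y‖
        ∂isoGaussian (EuclideanSpace ℂ ι) v =
      ENNReal.ofReal (‖s‖ ^ 2 / Fintype.card ι) *
        ∫⁻ y, φ ‖y‖ ∂isoGaussian (EuclideanSpace ℂ ι) v := by
  rcases isEmpty_or_nonempty ι with hι | hι
  · simp [Subsingleton.elim s 0]
  rcases eq_or_ne s 0 with rfl | hs
  · simp
  obtain ⟨i⟩ := id hι
  obtain ⟨b, hb⟩ := exists_orthonormalBasis_apply_eq (s := (‖s‖⁻¹ : ℂ) • s) i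
    (by simp [norm_smul, hs])
  have hs' : s = (‖s‖ : ℂ) • b i := by simp [hb, smul_smul, hs]
  have hscale (y : EuclideanSpace ℂ ι) :
      ENNReal.ofReal (‖inner ℂ s y‖ ^ 2 / ‖y‖ ^ 2) * φ ‖y‖ = ENNReal.ofReal (‖s‖ ^ 2) *
        (ENNReal.ofReal (‖inner ℂ (b i) y‖ ^ 2 / ‖y‖ ^ 2) * φ ‖y‖) := by
    have hinner : ‖inner ℂ s y‖ = ‖s‖ * ‖inner ℂ (b i) y‖ := by
      conv_lhs => rw [hs', inner_smul_left, norm_mul]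
      simp
    rw [hinner, mul_pow, mul_div_assoc, ENNReal.ofReal_mul (by positivity), mul_assoc]
  simp_rw [hscale]
  rw [lintegral_const_mul' _ _ ENNReal.ofReal_ne_top,
    lintegral_norm_inner_orthonormalBasis_sq_div_isoGaussian b i hv hφ, ← mul_assoc,
    div_eq_mul_inv, ENNReal.ofReal_mul (by positivity),
    ENNReal.ofReal_inv_of_pos (by exact_mod_cast Fintype.card_pos), ENNReal.ofReal_natCast]

lemma ae_inner_ne_zero_isoGaussian {s : EuclideanSpace ℂ ι} (hs : s ≠ 0) (v : ℝ) :
    ∀ᵐ y ∂isoGaussian (EuclideanSpace ℂ ι) v, inner ℂ s y ≠ 0 := by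
  have hproper : (ℂ ∙ s)ᗮ.restrictScalars ℝ ≠ ⊤ := fun htop => hs <| by
    have : s ∈ (ℂ ∙ s)ᗮ.restrictScalars ℝ := htop ▸ Submodule.mem_top
    simpa [Submodule.mem_orthogonal_singleton_iff_inner_right] using this
  refine isoGaussian_null_of_volume_null
    (Eq.trans (congrArg _ ?_) (Measure.addHaar_submodule volume _ hproper))
  ext y
  simp [Submodule.mem_orthogonal_singleton_iff_inner_right]

end ComplexGaussian

section Rejection

variable {E : Type*} [NormedAddCommGroup E] [InnerProductSpace ℂ E]

/-- The component of `h` orthogonal to the unit vector `q`. The explicit formula makes it jointly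
measurable in `q` and `h`. -/
noncomputable def rejection (q h : E) : E := h - inner ℂ q h • q

lemma inner_rejection_right {q : E} (hq : ‖q‖ = 1) (h : E) : inner ℂ q (rejection q h) = 0 := by
  simp [rejection, inner_self_eq_norm_sq_to_K, hq]

lemma inner_rejection_comm (q s h : E) :
    inner ℂ s (rejection q h) = inner ℂ (rejection q s) h := by
  simp [rejection]

lemma rejection_smul (q h : E) (a : ℂ) : rejection q (a • h) = a • rejection q h := by
  simp [rejection, smul_sub, mul_smul]

lemma norm_rejection_sq {q : E} (hq : ‖q‖ = 1) (h : E) :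
    ‖rejection q h‖ ^ 2 = ‖h‖ ^ 2 - ‖inner ℂ q h‖ ^ 2 := by
  have hpyth := norm_add_sq_eq_norm_sq_add_norm_sq_of_inner_eq_zero (𝕜 := ℂ) (rejection q h)
    (inner ℂ q h • q)
    (by rw [inner_smul_right, inner_eq_zero_symm.1 (inner_rejection_right hq h), mul_zero])
  rw [rejection, sub_add_cancel, norm_smul, hq, mul_one] at hpyth
  rw [rejection]
  linarith

lemma rejection_eq_starProjection {q : E} (hq : ‖q‖ = 1) (h : E) :
    rejection q h = (ℂ ∙ q)ᗮ.starProjection h := by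
  rw [Submodule.starProjection_orthogonal_val, Submodule.starProjection_unit_singleton ℂ hq,
    rejection]

lemma exists_isometry_apply_adjoint_eq_rejection {L : ℕ} {q : EuclideanSpace ℂ (Fin L)}
    (hq : ‖q‖ = 1) :
    ∃ U : EuclideanSpace ℂ (Fin (L - 1)) →ₗᵢ[ℂ] EuclideanSpace ℂ (Fin L),
      ∀ h, U (ContinuousLinearMap.adjoint U.toContinuousLinearMap h) = rejection q h := by
  have hrank : Module.finrank ℂ (ℂ ∙ q)ᗮ = L - 1 := by
    have hadd := Submodule.finrank_add_finrank_orthogonal (ℂ ∙ q)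
    rw [finrank_span_singleton (norm_ne_zero_iff.1 (by simp [hq])),
      finrank_euclideanSpace_fin] at hadd
    omega
  let b := (stdOrthonormalBasis ℂ (ℂ ∙ q)ᗮ).reindex (finCongr hrank)
  let U := (ℂ ∙ q)ᗮ.subtypeₗᵢ.comp b.repr.symm.toLinearIsometry
  refine ⟨U, fun h => ?_⟩
  have hadjoint : ContinuousLinearMap.adjoint U.toContinuousLinearMap h =
      b.repr ((ℂ ∙ q)ᗮ.orthogonalProjectionOnto h) := by
    refine ext_inner_left ℂ fun y => ?_
    rw [ContinuousLinearMap.adjoint_inner_right, ← b.repr.apply_symm_apply y,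
      b.repr.inner_map_map, Submodule.inner_orthogonalProjectionOnto_eq_of_mem_left]
    simp [U]
  rw [hadjoint, rejection_eq_starProjection hq]
  simp [U]

end Rejection

section ChannelShape

variable {L : ℕ}

lemma channelShape_smul {a : ℝ} (ha : 0 < a) (h : EuclideanSpace ℂ (Fin L)) :
    channelShape ((a : ℂ) • h) = channelShape h := by
  have ha' : (a : ℂ) ≠ 0 := by exact_mod_cast ha.ne'
  rw [channelShape, channelShape, norm_smul, smul_smul, Complex.norm_real,
    Real.norm_of_nonneg ha.le]
  congr 1
  push_cast
  field_simp

lemma channelShape_eq_real_inv_norm_smul (h : EuclideanSpace ℂ (Fin L)) :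
    channelShape h = ‖h‖⁻¹ • h := by
  rw [channelShape, ← Complex.ofReal_inv, Complex.coe_smul]

lemma norm_channelShape {h : EuclideanSpace ℂ (Fin L)} (hh : h ≠ 0) : ‖channelShape h‖ = 1 := by
  simp [channelShape, norm_smul, hh]

lemma channelShape_rejection_channelShape (q h : EuclideanSpace ℂ (Fin L)) :
    channelShape (rejection q (channelShape h)) = channelShape (rejection q h) := by
  rcases eq_or_ne h 0 with rfl | hh
  · simp [channelShape, rejection]
  · rw [show channelShape h = ((‖h‖⁻¹ : ℝ) : ℂ) • h by simp [channelShape], rejection_smul,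
      channelShape_smul (inv_pos.2 (norm_pos_iff.2 hh))]

lemma norm_inner_channelShape_sq (s h : EuclideanSpace ℂ (Fin L)) :
    ‖inner ℂ s (channelShape h)‖ ^ 2 = ‖inner ℂ s h‖ ^ 2 / ‖h‖ ^ 2 := by
  simp [channelShape, mul_pow, div_eq_inv_mul]

lemma lintegral_norm_inner_shape_rejection_sq_mul (hL : 2 ≤ L) {q : EuclideanSpace ℂ (Fin L)}
    (hq : ‖q‖ = 1) (s : EuclideanSpace ℂ (Fin L)) {φ : ℝ → ENNReal} (hφ : Measurable φ) :
    ∫⁻ h, ENNReal.ofReal (‖inner ℂ s (channelShape (rejection q h))‖ ^ 2) * φ (‖rejection q h‖ ^ 2)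
        ∂isoGaussian (EuclideanSpace ℂ (Fin L)) 1 =
      ENNReal.ofReal (‖rejection q s‖ ^ 2 / ((L : ℝ) - 1)) *
        ∫⁻ t, φ t ∂gammaMeasure ((L : ℝ) - 1) 1 := by
  obtain ⟨U, hU⟩ := exists_isometry_apply_adjoint_eq_rejection hq
  let Uadj := ContinuousLinearMap.adjoint U.toContinuousLinearMap
  have hnorm (h) : ‖rejection q h‖ = ‖Uadj h‖ := by rw [← hU, U.norm_map]
  have hinner (h) : inner ℂ s (rejection q h) = inner ℂ (Uadj s) (Uadj h) := by
    rw [← hU, ContinuousLinearMap.adjoint_inner_left]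
    rfl
  have hlaw := map_norm_sq_div_isoGaussian_euclideanSpace (n := L - 1) (by omega) one_pos
  simp only [div_one, Nat.cast_sub (show 1 ≤ L by omega), Nat.cast_one] at hlaw
  simp only [norm_inner_channelShape_sq, hnorm, hinner]
  rw [(measurePreserving_adjoint_isoGaussian U one_pos).lintegral_comp
      (f := fun y => ENNReal.ofReal (‖inner ℂ (Uadj s) y‖ ^ 2 / ‖y‖ ^ 2) * φ (‖y‖ ^ 2))
      (by fun_prop),
    lintegral_norm_inner_sq_div_isoGaussian (φ := fun r => φ (r ^ 2)) _ one_pos (by fun_prop),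
    ← hlaw, lintegral_map hφ (by fun_prop), Fintype.card_fin, Nat.cast_sub (by omega),
    Nat.cast_one]

lemma map_norm_rejection_sq_isoGaussian (hL : 2 ≤ L) {q : EuclideanSpace ℂ (Fin L)}
    (hq : ‖q‖ = 1) :
    (isoGaussian (EuclideanSpace ℂ (Fin L)) 1).map (fun h => ‖rejection q h‖ ^ 2) =
      gammaMeasure ((L : ℝ) - 1) 1 := by
  obtain ⟨U, hU⟩ := exists_isometry_apply_adjoint_eq_rejection hq
  have hlaw := map_norm_sq_div_isoGaussian_euclideanSpace (n := L - 1) (by omega) one_pos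
  have hmp := measurePreserving_adjoint_isoGaussian U one_pos
  rw [← hmp.map_eq, Measure.map_map (by fun_prop) hmp.measurable] at hlaw
  simpa [Function.comp_def, ← hU, Nat.cast_sub (show 1 ≤ L by omega)] using hlaw

lemma ae_inner_shape_rejection_ne_zero {q s : EuclideanSpace ℂ (Fin L)}
    (hs : rejection q s ≠ 0) (v : ℝ) :
    ∀ᵐ h ∂isoGaussian (EuclideanSpace ℂ (Fin L)) v,
      inner ℂ s (channelShape (rejection q h)) ≠ 0 := by
  filter_upwards [ae_inner_ne_zero_isoGaussian hs v] with h hh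
  have hne : inner ℂ s (rejection q h) ≠ 0 := by rwa [inner_rejection_comm]
  have : rejection q h ≠ 0 := fun h0 => hne (by simp [h0])
  simpa [channelShape, this] using hne

end ChannelShape

section PowerLaw

variable {Ω : Type*} [MeasurableSpace Ω] {μ : Measure Ω} [IsProbabilityMeasure μ] {X : Ω → ℝ}
  {D : ℝ} {n : ℕ}

lemma ae_le_of_cdf_eq_pow (hX : Measurable X) (hD : 0 < D)
    (hcdf : ∀ τ, 0 ≤ τ → τ ≤ D → μ.real {w | X w ≤ τ} = (τ / D) ^ n) : ∀ᵐ w ∂μ, X w ≤ D := by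
  have hone := hcdf D hD.le le_rfl
  rw [div_self hD.ne', one_pow, measureReal_def, ENNReal.toReal_eq_one_iff] at hone
  exact (prob_compl_eq_zero_iff (hX measurableSet_Iic)).2 hone

lemma ae_ne_zero_of_cdf_eq_pow (hn : n ≠ 0) (hD : 0 < D)
    (hcdf : ∀ τ, 0 ≤ τ → τ ≤ D → μ.real {w | X w ≤ τ} = (τ / D) ^ n) : ∀ᵐ w ∂μ, X w ≠ 0 := by
  have hzero := hcdf 0 le_rfl hD.le
  rw [zero_div, zero_pow hn, measureReal_eq_zero_iff] at hzero
  exact measure_mono_null (fun w hw => (not_not.1 hw).le) hzero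

lemma lintegral_of_cdf_eq_pow (hX : Measurable X) (hX0 : ∀ᵐ w ∂μ, 0 ≤ X w) (hD : 0 < D)
    (hcdf : ∀ τ, 0 ≤ τ → τ ≤ D → μ.real {w | X w ≤ τ} = (τ / D) ^ n) :
    ∫⁻ w, ENNReal.ofReal (X w) ∂μ = ENNReal.ofReal (n / (n + 1) * D) := by
  have htail : ∀ t ∈ Ioi (0 : ℝ), μ {w | t < X w} =
      (Ioc 0 D).indicator (fun t => ENNReal.ofReal (1 - (t / D) ^ n)) t := by
    intro t (ht : 0 < t)
    rcases le_or_gt t D with htD | htD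
    · have hcompl : {w | t < X w} = {w | X w ≤ t}ᶜ := by ext; simp
      rw [indicator_of_mem (mem_Ioc.2 ⟨ht, htD⟩), ← hcdf t ht.le htD, hcompl, ← ofReal_measureReal,
        probReal_compl_eq_one_sub (s := {w | X w ≤ t}) (hX measurableSet_Iic)]
    · rw [indicator_of_notMem fun h => htD.not_ge h.2]
      exact measure_mono_null (fun w (hw : t < X w) => (htD.trans hw).not_ge)
        (ae_le_of_cdf_eq_pow hX hD hcdf)
  have hintegral : ∫ t in 0..D, (1 - (t / D) ^ n) = n / (n + 1) * D := by
    have hn : (n : ℝ) + 1 ≠ 0 := by positivity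
    simp only [div_pow]
    rw [intervalIntegral.integral_sub (by simp) (by apply Continuous.intervalIntegrable; fun_prop),
      intervalIntegral.integral_div, integral_pow]
    simp
    field_simp
    ring
  have hnonneg : 0 ≤ᵐ[volume.restrict (Ioc 0 D)] fun t => 1 - (t / D) ^ n := by
    refine (ae_restrict_mem measurableSet_Ioc).mono fun t ht => sub_nonneg.2 ?_
    exact pow_le_one₀ (div_nonneg ht.1.le hD.le) ((div_le_one hD).2 ht.2)
  have hcont : Continuous fun t : ℝ => 1 - (t / D) ^ n := by fun_prop
  rw [lintegral_eq_lintegral_meas_lt _ hX0 hX.aemeasurable,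
    setLIntegral_congr_fun measurableSet_Ioi htail, setLIntegral_indicator measurableSet_Ioc,
    inter_eq_left.2 fun t ht => ht.1, ← ofReal_integral_eq_lintegral_ofReal _ hnonneg,
    ← intervalIntegral.integral_of_le hD.le, hintegral]
  exact (hcont.integrableOn_Icc).mono_set Ioc_subset_Icc_self

end PowerLaw

/-- The bound `2 ^ (-B / (L - 1))` on the error of a `B`-bit quantizer of the channel shape. -/
noncomputable def cdiBound (L B : ℕ) : ℝ := 2 ^ (-((B : ℝ) / ((L : ℝ) - 1)))

lemma natCast_sub_one_pos {L : ℕ} (hL : 2 ≤ L) : (0 : ℝ) < L - 1 := by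
  have : (2 : ℝ) ≤ L := by exact_mod_cast hL
  linarith

lemma cdiBound_pos (L B : ℕ) : 0 < cdiBound L B := Real.rpow_pos_of_pos two_pos _

lemma two_pow_mul_pow_eq_div_cdiBound_pow {L : ℕ} (hL : 2 ≤ L) (B : ℕ) (τ : ℝ) :
    2 ^ B * τ ^ (L - 1) = (τ / cdiBound L B) ^ (L - 1) := by
  have hL' := (natCast_sub_one_pos hL).ne'
  have hpow : cdiBound L B ^ (L - 1) = (2 ^ B)⁻¹ := by
    rw [cdiBound, ← Real.rpow_natCast, ← Real.rpow_mul two_pos.le, Nat.cast_sub (by omega),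
      Nat.cast_one, neg_mul, div_mul_cancel₀ _ hL', Real.rpow_neg two_pos.le, Real.rpow_natCast]
  rw [div_pow, hpow, div_inv_eq_mul, mul_comm]

@[fun_prop]
lemma measurable_channelShape {L : ℕ} : Measurable (channelShape (L := L)) := by
  unfold channelShape
  fun_prop

@[fun_prop]
lemma measurable_rejection {L : ℕ} {α : Type*} [MeasurableSpace α]
    {q h : α → EuclideanSpace ℂ (Fin L)} (hq : Measurable q) (hh : Measurable h) :
    Measurable fun x => rejection (q x) (h x) := by
  unfold rejection
  fun_prop

namespace CognitiveLink

variable {L : ℕ} {c : LinkParams} {B : ℕ} {Ω : Type*} [MeasurableSpace Ω] {μ : Measure Ω}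
  (S : CognitiveLink L c B μ)

/-- The power of the component of `h_s` orthogonal to `ŝ_x`. The OCB beamformer of power `P`
achieves the receive SNR `P * projPower / σ²`. -/
noncomputable def projPower (w : Ω) : ℝ := ‖rejection (S.sxHat w) (S.hs w)‖ ^ 2

lemma norm_sx {w : Ω} (hw : S.hx w ≠ 0) : ‖S.sx w‖ = 1 := norm_channelShape hw

lemma norm_sxHat {w : Ω} (hw : S.hx w ≠ 0) : ‖S.sxHat w‖ = 1 :=
  S.norm_quantizer _ _ (S.norm_sx hw)

lemma epsilon_eq_norm_rejection_sq {w : Ω} (hw : S.hx w ≠ 0) :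
    S.epsilon w = ‖rejection (S.sxHat w) (S.sx w)‖ ^ 2 := by
  rw [norm_rejection_sq (S.norm_sxHat hw), S.norm_sx hw, epsilon, one_pow]

lemma epsilon_nonneg {w : Ω} (hw : S.hx w ≠ 0) : 0 ≤ S.epsilon w := by
  rw [S.epsilon_eq_norm_rejection_sq hw]; positivity

lemma gx_nonneg (w : Ω) : 0 ≤ S.gx w := by unfold gx; positivity

lemma gx_pos {w : Ω} (hw : S.hx w ≠ 0) : 0 < S.gx w :=
  div_pos (pow_pos (norm_pos_iff.2 hw) 2) (by exact_mod_cast c.pathGain_pos)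

lemma delta_nonneg (w : Ω) : 0 ≤ S.delta w := sq_nonneg _

lemma delta_eq_norm_inner_shape_rejection_sq (w : Ω) :
    S.delta w = ‖inner ℂ (S.sx w) (channelShape (rejection (S.sxHat w) (S.hs w)))‖ ^ 2 := by
  rw [← channelShape_rejection_channelShape]
  rfl

@[fun_prop]
lemma measurable_gp : Measurable S.gp := by
  have := S.measurable_hp
  unfold gp
  fun_prop

@[fun_prop]
lemma measurable_gx : Measurable S.gx := by
  have := S.measurable_hx
  unfold gx
  fun_prop

@[fun_prop]
lemma measurable_sx : Measurable S.sx := measurable_channelShape.comp S.measurable_hx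

@[fun_prop]
lemma measurable_sxHat : Measurable S.sxHat :=
  S.measurable_quantizer.comp (S.measurable_sx.prodMk S.measurable_seed)

@[fun_prop]
lemma measurable_epsilon : Measurable S.epsilon := by
  unfold epsilon
  fun_prop

@[fun_prop]
lemma measurable_delta : Measurable S.delta := by
  have := S.measurable_hs
  rw [funext S.delta_eq_norm_inner_shape_rejection_sq]
  fun_prop

@[fun_prop]
lemma measurable_projPower : Measurable S.projPower := by
  have := S.measurable_hs
  unfold projPower
  fun_prop

lemma indepFun_gp_rest :
    IndepFun S.gp (fun w => (S.gx w, S.epsilon w, S.delta w, S.projPower w)) μ := by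
  have hq := S.measurable_quantizer
  let q (y : EuclideanSpace ℂ (Fin L) × EuclideanSpace ℂ (Fin L) × ℝ) :=
    Function.uncurry S.quantizer (channelShape y.1, y.2.2)
  have hqm : Measurable q := by fun_prop
  exact S.indep_hp_rest.comp (φ := fun z => ‖z‖ ^ 2) (ψ := fun y =>
    (‖y.1‖ ^ 2 / (c.pathGain : ℝ), 1 - ‖inner ℂ (q y) (channelShape y.1)‖ ^ 2,
      ‖inner ℂ (channelShape y.1) (channelShape (rejection (q y) (channelShape y.2.1)))‖ ^ 2,
      ‖rejection (q y) y.2.1‖ ^ 2)) (by fun_prop) (by fun_prop)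

lemma map_gp : μ.map S.gp = gammaMeasure 1 1 := by
  have hlaw := map_norm_sq_div_isoGaussian (V := ℂ) one_pos
  rw [← NNReal.coe_one, ← complexGaussian_eq_isoGaussian one_pos, ← S.law_hp,
    Measure.map_map (by fun_prop) S.measurable_hp, Complex.finrank_real_complex] at hlaw
  simp only [NNReal.coe_one, div_one] at hlaw
  norm_num at hlaw
  exact hlaw

section Laws

variable [IsProbabilityMeasure μ]

lemma map_hx : μ.map S.hx = isoGaussian (EuclideanSpace ℂ (Fin L)) c.pathGain :=
  map_eq_isoGaussian_of_iIndepFun c.pathGain_pos S.measurable_hx S.law_hx S.indep_hx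

lemma map_hs : μ.map S.hs = isoGaussian (EuclideanSpace ℂ (Fin L)) 1 :=
  map_eq_isoGaussian_of_iIndepFun one_pos S.measurable_hs S.law_hs S.indep_hs

lemma map_gx (hL : L ≠ 0) : μ.map S.gx = gammaMeasure L 1 := by
  rw [← map_norm_sq_div_isoGaussian_euclideanSpace hL
      (NNReal.coe_pos.2 c.pathGain_pos), ← S.map_hx,
    Measure.map_map (by fun_prop) S.measurable_hx]
  rfl

lemma ae_hx_ne_zero (hL : L ≠ 0) : ∀ᵐ w ∂μ, S.hx w ≠ 0 := by
  have : Nonempty (Fin L) := ⟨⟨0, Nat.pos_of_ne_zero hL⟩⟩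
  exact ae_of_ae_map S.measurable_hx.aemeasurable (S.map_hx ▸ ae_ne_zero_isoGaussian _)

lemma indepFun_hs_rest :
    IndepFun S.hs (fun w => (S.gx w, S.sx w, S.sxHat w)) μ := by
  have hindep := indepFun_prodMk_of_indepFun_prodMk S.measurable_hx S.measurable_hs
    S.measurable_seed S.indep_hx_rest S.indep_hs_seed
  have hq := S.measurable_quantizer
  exact hindep.comp (ψ := fun y : EuclideanSpace ℂ (Fin L) × ℝ =>
    (‖y.1‖ ^ 2 / (c.pathGain : ℝ), channelShape y.1,
      Function.uncurry S.quantizer (channelShape y.1, y.2))) measurable_id (by fun_prop)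

lemma indepFun_norm_hx_sx (hL : L ≠ 0) : IndepFun (fun w => ‖S.hx w‖) S.sx μ := by
  have : Nonempty (Fin L) := ⟨⟨0, Nat.pos_of_ne_zero hL⟩⟩
  have hiso := indepFun_norm_direction_isoGaussian (V := EuclideanSpace ℂ (Fin L))
    (NNReal.coe_pos.2 c.pathGain_pos)
  rw [← S.map_hx] at hiso
  have hdir : S.sx = fun w => (‖S.hx w‖)⁻¹ • S.hx w :=
    funext fun w => channelShape_eq_real_inv_norm_smul _
  exact hdir ▸ indepFun_comp_of_indepFun_map S.measurable_hx (by fun_prop) (by fun_prop) hiso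

lemma indepFun_gx_epsilon (hL : L ≠ 0) : IndepFun S.gx S.epsilon μ := by
  have hseed : IndepFun S.seed (fun w => (‖S.hx w‖, S.sx w)) μ :=
    (S.indep_hx_rest.comp (φ := fun x => (‖x‖, channelShape x)) (by fun_prop)
      measurable_snd).symm
  have hindep := indepFun_prodMk_of_indepFun_prodMk S.measurable_seed
    S.measurable_hx.norm S.measurable_sx hseed (S.indepFun_norm_hx_sx hL)
  have hq := S.measurable_quantizer
  have herror : Measurable fun y : ℝ × EuclideanSpace ℂ (Fin L) =>
      1 - ‖inner ℂ (Function.uncurry S.quantizer (y.2, y.1)) y.2‖ ^ 2 := by fun_prop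
  have hpower : Measurable fun r : ℝ => r ^ 2 / (c.pathGain : ℝ) := by fun_prop
  exact hindep.comp hpower herror

end Laws

section Moments

lemma measureReal_epsilon_le (hL : 2 ≤ L) (τ : ℝ) (hτ : 0 ≤ τ) (hτD : τ ≤ cdiBound L B) :
    μ.real {w | S.epsilon w ≤ τ} = (τ / cdiBound L B) ^ (L - 1) := by
  rw [← two_pow_mul_pow_eq_div_cdiBound_pow hL]
  exact S.cdf_error τ hτ hτD

variable [IsProbabilityMeasure μ]

lemma ae_epsilon_le (hL : 2 ≤ L) : ∀ᵐ w ∂μ, S.epsilon w ≤ cdiBound L B :=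
  ae_le_of_cdf_eq_pow S.measurable_epsilon (cdiBound_pos L B) (S.measureReal_epsilon_le hL)

lemma ae_epsilon_pos (hL : 2 ≤ L) : ∀ᵐ w ∂μ, 0 < S.epsilon w := by
  filter_upwards [S.ae_hx_ne_zero (by omega), ae_ne_zero_of_cdf_eq_pow (by omega)
    (cdiBound_pos L B) (S.measureReal_epsilon_le hL)] with w hx hε
  exact (S.epsilon_nonneg hx).lt_of_ne' hε

lemma lintegral_epsilon (hL : 2 ≤ L) :
    ∫⁻ w, ENNReal.ofReal (S.epsilon w) ∂μ =
      ENNReal.ofReal (((L : ℝ) - 1) / L * cdiBound L B) := by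
  rw [lintegral_of_cdf_eq_pow S.measurable_epsilon
    ((S.ae_hx_ne_zero (by omega)).mono fun _ => S.epsilon_nonneg) (cdiBound_pos L B)
    (S.measureReal_epsilon_le hL), Nat.cast_sub (by omega), Nat.cast_one, sub_add_cancel]

lemma lintegral_gx_rpow (hL : L ≠ 0) {p : ℝ} (hp : 0 < L + p) :
    ∫⁻ w, ENNReal.ofReal (S.gx w ^ p) ∂μ =
      ENNReal.ofReal (Real.Gamma (L + p) / Real.Gamma L) := by
  rw [← lintegral_rpow_gammaMeasure (by positivity) hp, ← S.map_gx hL,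
    lintegral_map (by fun_prop) S.measurable_gx]

lemma lintegral_gx (hL : L ≠ 0) : ∫⁻ w, ENNReal.ofReal (S.gx w) ∂μ = ENNReal.ofReal L := by
  have hΓ := (Real.Gamma_pos_of_pos (s := L) (by positivity)).ne'
  have hmean := S.lintegral_gx_rpow hL (p := 1) (by positivity)
  rw [Real.Gamma_add_one (by positivity), mul_div_cancel_right₀ _ hΓ] at hmean
  simpa only [Real.rpow_one] using hmean

lemma lintegral_gx_sq (hL : L ≠ 0) :
    ∫⁻ w, ENNReal.ofReal (S.gx w ^ 2) ∂μ = ENNReal.ofReal (L * (L + 1)) := by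
  have hΓ := (Real.Gamma_pos_of_pos (s := L) (by positivity)).ne'
  have hmean := S.lintegral_gx_rpow hL (p := 2) (by positivity)
  have hΓ2 : Real.Gamma (L + 2) / Real.Gamma L = L * (L + 1) := by
    rw [show (L : ℝ) + 2 = L + 1 + 1 by ring, Real.Gamma_add_one (by positivity),
      Real.Gamma_add_one (by positivity)]
    field_simp
  simpa only [Real.rpow_two, hΓ2] using hmean

lemma lintegral_gx_mul_epsilon (hL : 2 ≤ L) :
    ∫⁻ w, ENNReal.ofReal (S.gx w * S.epsilon w) ∂μ =
      ENNReal.ofReal (((L : ℝ) - 1) * cdiBound L B) := by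
  have hL0 : (L : ℝ) ≠ 0 := by positivity
  have hindep := (S.indepFun_gx_epsilon (by omega)).comp ENNReal.measurable_ofReal
    ENNReal.measurable_ofReal
  simp only [ENNReal.ofReal_mul (S.gx_nonneg _)]
  refine (lintegral_mul_eq_lintegral_mul_lintegral_of_indepFun (by fun_prop) (by fun_prop)
    hindep).trans ?_
  simp only [Function.comp_apply]
  rw [S.lintegral_gx (by omega), S.lintegral_epsilon hL, ← ENNReal.ofReal_mul (by positivity)]
  congr 1
  field_simp

lemma lintegral_gx_mul_epsilon_sq_le (hL : 2 ≤ L) :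
    ∫⁻ w, ENNReal.ofReal ((S.gx w * S.epsilon w) ^ 2) ∂μ ≤
      ENNReal.ofReal (L * (L + 1) * cdiBound L B ^ 2) := by
  have hle : ∀ᵐ w ∂μ, ENNReal.ofReal ((S.gx w * S.epsilon w) ^ 2) ≤
      ENNReal.ofReal (S.gx w ^ 2) * ENNReal.ofReal (cdiBound L B ^ 2) := by
    filter_upwards [S.ae_epsilon_le hL, S.ae_epsilon_pos hL] with w hle hpos
    rw [← ENNReal.ofReal_mul (by positivity), mul_pow]
    gcongr
  calc _ ≤ ∫⁻ w, ENNReal.ofReal (S.gx w ^ 2) * ENNReal.ofReal (cdiBound L B ^ 2) ∂μ :=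
        lintegral_mono_ae hle
    _ = _ := by
      rw [lintegral_mul_const _ (by fun_prop), S.lintegral_gx_sq (by omega),
        ← ENNReal.ofReal_mul (by positivity)]

lemma lintegral_gx_mul_delta_mul (hL : 2 ≤ L) {φ : ℝ → ENNReal} (hφ : Measurable φ) :
    ∫⁻ w, ENNReal.ofReal (S.gx w * S.delta w) * φ (S.projPower w) ∂μ =
      ENNReal.ofReal (cdiBound L B) * ∫⁻ t, φ t ∂gammaMeasure ((L : ℝ) - 1) 1 := by
  have hL1 := natCast_sub_one_pos hL
  let F (z : EuclideanSpace ℂ (Fin L) × ℝ × EuclideanSpace ℂ (Fin L) ×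
      EuclideanSpace ℂ (Fin L)) : ENNReal :=
    ENNReal.ofReal (z.2.1 * ‖inner ℂ z.2.2.1 (channelShape (rejection z.2.2.2 z.1))‖ ^ 2) *
      φ (‖rejection z.2.2.2 z.1‖ ^ 2)
  have hcond : ∀ᵐ w ∂μ, ∫⁻ h, F (h, S.gx w, S.sx w, S.sxHat w) ∂(μ.map S.hs) =
      ENNReal.ofReal (S.gx w * S.epsilon w) *
        (ENNReal.ofReal ((L : ℝ) - 1)⁻¹ * ∫⁻ t, φ t ∂gammaMeasure ((L : ℝ) - 1) 1) := by
    filter_upwards [S.ae_hx_ne_zero (by omega)] with w hw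
    simp only [F, ENNReal.ofReal_mul (S.gx_nonneg w), mul_assoc]
    rw [lintegral_const_mul _ (by fun_prop), S.map_hs,
      lintegral_norm_inner_shape_rejection_sq_mul hL (S.norm_sxHat hw) _ hφ,
      ← S.epsilon_eq_norm_rejection_sq hw, div_eq_mul_inv,
      ENNReal.ofReal_mul (S.epsilon_nonneg hw), mul_assoc]
  simp only [S.delta_eq_norm_inner_shape_rejection_sq, projPower]
  rw [lintegral_comp_of_indepFun S.measurable_hs (by fun_prop) S.indepFun_hs_rest
    (F := F) (by fun_prop), lintegral_congr_ae hcond, lintegral_mul_const _ (by fun_prop),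
    S.lintegral_gx_mul_epsilon hL, ← mul_assoc,
    ← ENNReal.ofReal_mul (mul_nonneg hL1.le (cdiBound_pos L B).le)]
  congr 2
  field_simp

lemma map_projPower (hL : 2 ≤ L) : μ.map S.projPower = gammaMeasure ((L : ℝ) - 1) 1 := by
  refine Measure.ext fun I hI => ?_
  let s : Set (EuclideanSpace ℂ (Fin L) × ℝ × EuclideanSpace ℂ (Fin L) ×
      EuclideanSpace ℂ (Fin L)) := {z | ‖rejection z.2.2.2 z.1‖ ^ 2 ∈ I}
  have hs : MeasurableSet s := hI.preimage (by fun_prop)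
  have hcond : ∀ᵐ w ∂μ, μ.map S.hs {h | (h, S.gx w, S.sx w, S.sxHat w) ∈ s} =
      gammaMeasure ((L : ℝ) - 1) 1 I := by
    filter_upwards [S.ae_hx_ne_zero (by omega)] with w hw
    rw [S.map_hs, ← map_norm_rejection_sq_isoGaussian hL (S.norm_sxHat hw),
      Measure.map_apply (by fun_prop) hI]
    rfl
  calc μ.map S.projPower I = μ {w | (S.hs w, S.gx w, S.sx w, S.sxHat w) ∈ s} :=
        Measure.map_apply S.measurable_projPower hI
    _ = ∫⁻ _, gammaMeasure ((L : ℝ) - 1) 1 I ∂μ := by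
        rw [measure_prodMk_mem_of_indepFun S.measurable_hs (by fun_prop) S.indepFun_hs_rest hs,
          lintegral_congr_ae hcond]
    _ = gammaMeasure ((L : ℝ) - 1) 1 I := by simp

lemma ae_delta_ne_zero (hL : 2 ≤ L) : ∀ᵐ w ∂μ, S.delta w ≠ 0 := by
  let s : Set (EuclideanSpace ℂ (Fin L) × ℝ × EuclideanSpace ℂ (Fin L) ×
      EuclideanSpace ℂ (Fin L)) :=
    {z | inner ℂ z.2.2.1 (channelShape (rejection z.2.2.2 z.1)) = 0}
  have hs : MeasurableSet s := measurableSet_eq_fun (by fun_prop) (by fun_prop)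
  have hnull : ∀ᵐ w ∂μ, μ.map S.hs {h | (h, S.gx w, S.sx w, S.sxHat w) ∈ s} = 0 := by
    filter_upwards [S.ae_hx_ne_zero (by omega), S.ae_epsilon_pos hL] with w hx hε
    have hne : rejection (S.sxHat w) (S.sx w) ≠ 0 := fun h => by
      simp [S.epsilon_eq_norm_rejection_sq hx, h] at hε
    simpa [s, ae_iff, S.map_hs] using ae_inner_shape_rejection_ne_zero hne 1
  have hzero : μ {w | (S.hs w, S.gx w, S.sx w, S.sxHat w) ∈ s} = 0 := by
    rw [measure_prodMk_mem_of_indepFun S.measurable_hs (by fun_prop) S.indepFun_hs_rest hs,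
      lintegral_congr_ae hnull, lintegral_zero]
  refine measure_mono_null (fun w hw => ?_) hzero
  simpa [s, delta_eq_norm_inner_shape_rejection_sq] using hw

end Moments

end CognitiveLink

namespace LinkParams

variable (c : LinkParams)

lemma gammaP_pos : 0 < c.gammaP := div_pos c.powerPU_pos c.noise_pos

lemma gammaMax_pos : 0 < c.gammaMax := div_pos c.powerMax_pos c.noise_pos

/-- The primary channel power `θ_p / γ_p` at which the interference margin vanishes. -/
noncomputable def gpMin : ℝ := c.thetaP / c.gammaP

lemma gpMin_pos : 0 < c.gpMin := div_pos c.thetaP_pos c.gammaP_pos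

/-- The rate of the exponential law of the interference margin, given that it is nonnegative. -/
noncomputable def marginRate : ℝ := c.gpMin / c.noise

lemma marginRate_pos : 0 < c.marginRate := div_pos c.gpMin_pos c.noise_pos

end LinkParams

namespace CognitiveLink

variable {L : ℕ} {c : LinkParams} {B : ℕ} {Ω : Type*} [MeasurableSpace Ω] {μ : Measure Ω}
  (S : CognitiveLink L c B μ)

section Margin

lemma margin_eq (w : Ω) : S.margin w = (S.gp w - c.gpMin) / c.marginRate := by
  have := c.gammaP_pos
  have := c.noise_pos
  have := c.thetaP_pos
  unfold margin LinkParams.marginRate LinkParams.gpMin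
  field_simp

lemma margin_nonneg_iff (w : Ω) : 0 ≤ S.margin w ↔ c.thetaP ≤ c.gammaP * S.gp w := by
  rw [margin, mul_nonneg_iff_of_pos_left c.noise_pos, sub_nonneg, one_le_div c.thetaP_pos]

lemma le_margin_iff {w : Ω} {a : ℝ} :
    a ≤ S.margin w ↔ c.gpMin + c.marginRate * a ≤ S.gp w := by
  rw [margin_eq, le_div_iff₀ c.marginRate_pos, mul_comm, le_sub_iff_add_le']

lemma margin_le_iff {w : Ω} {a : ℝ} :
    S.margin w ≤ a ↔ S.gp w ≤ c.gpMin + c.marginRate * a := by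
  rw [margin_eq, div_le_iff₀ c.marginRate_pos, mul_comm, sub_le_iff_le_add']

@[fun_prop]
lemma measurable_margin : Measurable S.margin := by
  unfold margin
  fun_prop

lemma indepFun_margin_rest :
    IndepFun S.margin (fun w => (S.gx w, S.epsilon w, S.delta w, S.projPower w)) μ :=
  S.indepFun_gp_rest.comp (φ := fun g => c.noise * (c.gammaP * g / c.thetaP - 1)) (by fun_prop)
    measurable_id

lemma measure_margin_nonneg :
    μ {w | 0 ≤ S.margin w} = ENNReal.ofReal (Real.exp (-c.gpMin)) := by
  rw [← gammaMeasure_one_one_Ici c.gpMin_pos, ← S.map_gp,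
    Measure.map_apply S.measurable_gp measurableSet_Ici]
  simp only [le_margin_iff, mul_zero, add_zero]
  rfl

lemma map_margin_Icc {a b : ℝ} (ha : 0 ≤ a) (hab : a ≤ b) :
    μ.map S.margin (Icc a b) = ENNReal.ofReal (Real.exp (-c.gpMin) *
      (Real.exp (-(c.marginRate * a)) - Real.exp (-(c.marginRate * b)))) := by
  have hκ := c.marginRate_pos
  have hpre : S.margin ⁻¹' Icc a b =
      S.gp ⁻¹' Icc (c.gpMin + c.marginRate * a) (c.gpMin + c.marginRate * b) := by
    ext w
    simp only [mem_preimage, mem_Icc, le_margin_iff, margin_le_iff]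
  rw [Measure.map_apply S.measurable_margin measurableSet_Icc, hpre,
    ← Measure.map_apply S.measurable_gp measurableSet_Icc, S.map_gp,
    gammaMeasure_one_one_Icc (add_pos_of_pos_of_nonneg c.gpMin_pos (by positivity)) (by gcongr),
    neg_add, neg_add, Real.exp_add, Real.exp_add, mul_sub]

lemma map_margin_Icc_le {a b : ℝ} (ha : 0 ≤ a) (hab : a ≤ b) :
    μ.map S.margin (Icc a b) ≤
      ENNReal.ofReal (Real.exp (-c.gpMin) * c.marginRate * (b - a)) := by
  have hκ := c.marginRate_pos
  rw [S.map_margin_Icc ha hab, mul_assoc, mul_sub c.marginRate]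
  exact ENNReal.ofReal_le_ofReal (mul_le_mul_of_nonneg_left
    (exp_neg_sub_exp_neg_le (by positivity) (by gcongr)) (Real.exp_pos _).le)

lemma le_map_margin_Ioc {a b : ℝ} (ha : 0 ≤ a) (hab : a ≤ b) :
    ENNReal.ofReal (Real.exp (-c.gpMin) *
        (c.marginRate * (b - a) - (c.marginRate * b) ^ 2)) ≤ μ.map S.margin (Ioc a b) := by
  have hκ := c.marginRate_pos
  have hnull : μ.map S.margin {a} = 0 := by
    rw [← Icc_self, S.map_margin_Icc ha le_rfl, sub_self, mul_zero, ENNReal.ofReal_zero]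
  rw [measure_congr (Ioc_ae_eq_Icc' hnull), S.map_margin_Icc ha hab, mul_sub c.marginRate]
  exact ENNReal.ofReal_le_ofReal (mul_le_mul_of_nonneg_left
    (sub_sub_sq_le_exp_neg_sub_exp_neg (by positivity) (by gcongr)) (Real.exp_pos _).le)

lemma map_margin_Icc_mul_gain_le (w : Ω) {a b : ℝ} (ha : 0 ≤ a) (hab : a ≤ b) :
    μ.map S.margin (Icc (a * (c.pathGain * S.gx w * S.delta w))
        (b * (c.pathGain * S.gx w * S.delta w))) ≤
      ENNReal.ofReal (Real.exp (-c.gpMin) * c.marginRate * c.pathGain) *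
        (ENNReal.ofReal (S.gx w * S.delta w) * ENNReal.ofReal (b - a)) := by
  have hκ := c.marginRate_pos
  have hgd := mul_nonneg (S.gx_nonneg w) (S.delta_nonneg w)
  have hgain : 0 ≤ c.pathGain * S.gx w * S.delta w := by
    rw [mul_assoc]; exact mul_nonneg c.pathGain.2 hgd
  rw [← ENNReal.ofReal_mul hgd, ← ENNReal.ofReal_mul (by positivity)]
  refine (S.map_margin_Icc_le (mul_nonneg ha hgain)
    (mul_le_mul_of_nonneg_right hab hgain)).trans_eq ?_
  congr 1
  ring

end Margin

section CellBounds

variable [IsProbabilityMeasure μ]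

lemma measure_projPower_mem_and_margin_mem_le (hL : 2 ≤ L) {I : Set ℝ} (hI : MeasurableSet I)
    {a b : ℝ → ℝ} (ha : Measurable a) (hb : Measurable b) (ha0 : ∀ t ∈ I, 0 ≤ a t)
    (hab : ∀ t ∈ I, a t ≤ b t) :
    μ {w | S.projPower w ∈ I ∧
        S.margin w ∈ Icc (a (S.projPower w) * (c.pathGain * S.gx w * S.delta w))
          (b (S.projPower w) * (c.pathGain * S.gx w * S.delta w))} ≤
      ENNReal.ofReal (Real.exp (-c.gpMin) * c.marginRate * c.pathGain * cdiBound L B) *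
        ∫⁻ t in I, ENNReal.ofReal (b t - a t) ∂gammaMeasure ((L : ℝ) - 1) 1 := by
  have hκ := c.marginRate_pos
  let s : Set (ℝ × ℝ × ℝ × ℝ × ℝ) := {z | z.2.2.2.2 ∈ I ∧
    z.1 ∈ Icc (a z.2.2.2.2 * (c.pathGain * z.2.1 * z.2.2.2.1))
      (b z.2.2.2.2 * (c.pathGain * z.2.1 * z.2.2.2.1))}
  have hlow : Measurable fun z : ℝ × ℝ × ℝ × ℝ × ℝ =>
      a z.2.2.2.2 * (c.pathGain * z.2.1 * z.2.2.2.1) := by fun_prop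
  have hupp : Measurable fun z : ℝ × ℝ × ℝ × ℝ × ℝ =>
      b z.2.2.2.2 * (c.pathGain * z.2.1 * z.2.2.2.1) := by fun_prop
  have hs : MeasurableSet s :=
    (hI.preimage (f := fun z : ℝ × ℝ × ℝ × ℝ × ℝ => z.2.2.2.2) (by fun_prop)).inter
      ((measurableSet_le hlow measurable_fst).inter (measurableSet_le measurable_fst hupp))
  have hfiber (w : Ω) : μ.map S.margin
      {x | (x, S.gx w, S.epsilon w, S.delta w, S.projPower w) ∈ s} ≤
      ENNReal.ofReal (Real.exp (-c.gpMin) * c.marginRate * c.pathGain) *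
        (ENNReal.ofReal (S.gx w * S.delta w) *
          I.indicator (fun t => ENNReal.ofReal (b t - a t)) (S.projPower w)) := by
    by_cases hw : S.projPower w ∈ I
    · simp only [s, mem_ofPred_eq, hw, true_and, indicator_of_mem]
      exact S.map_margin_Icc_mul_gain_le w (ha0 _ hw) (hab _ hw)
    · simp [s, hw]
  calc _ = ∫⁻ w, μ.map S.margin
        {x | (x, S.gx w, S.epsilon w, S.delta w, S.projPower w) ∈ s} ∂μ :=
        measure_prodMk_mem_of_indepFun S.measurable_margin (by fun_prop) S.indepFun_margin_rest hs
    _ ≤ _ := lintegral_mono hfiber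
    _ = _ := by
      have hφ : Measurable (I.indicator fun t => ENNReal.ofReal (b t - a t)) :=
        Measurable.indicator (by fun_prop) hI
      rw [lintegral_const_mul _ (by fun_prop), S.lintegral_gx_mul_delta_mul hL hφ, ← mul_assoc,
        ← ENNReal.ofReal_mul (by positivity), lintegral_indicator hI]

lemma measure_outage_etaFF_le (hL : 2 ≤ L) {x y : ℝ} (hx : 0 < x) (hy : 0 ≤ y) :
    μ {w | x < S.projPower w ∧ 0 ≤ S.margin w ∧
        S.margin w ≤ y / S.projPower w * (c.pathGain * S.gx w * S.delta w)} ≤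
      ENNReal.ofReal (Real.exp (-c.gpMin) * c.marginRate * c.pathGain * cdiBound L B *
        (y * (upperGamma ((L : ℝ) - 2) x / Real.Gamma ((L : ℝ) - 1)))) := by
  have hκ := c.marginRate_pos
  have hD := cdiBound_pos L B
  have hint : IntegrableOn (fun t => t ^ ((L : ℝ) - 1 + -1 - 1) * Real.exp (-t)) (Ioi x) :=
    integrableOn_rpow_mul_exp_neg_Ioi _ hx
  have hinv : ∫⁻ t in Ioi x, ENNReal.ofReal (y / t - 0) ∂gammaMeasure ((L : ℝ) - 1) 1 =
      ENNReal.ofReal (y * (upperGamma ((L : ℝ) - 2) x / Real.Gamma ((L : ℝ) - 1))) := by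
    simp only [sub_zero, div_eq_mul_inv y, ENNReal.ofReal_mul hy, ← Real.rpow_neg_one]
    rw [lintegral_const_mul _ (by fun_prop),
      setLIntegral_rpow_gammaMeasure (natCast_sub_one_pos hL) hx.le hint]
    ring_nf
  rw [ENNReal.ofReal_mul (by positivity), ← hinv]
  refine le_trans (measure_mono ?_) (S.measure_projPower_mem_and_margin_mem_le hL
    measurableSet_Ioi measurable_const (by fun_prop) (fun _ _ => le_rfl)
    fun t (ht : x < t) => div_nonneg hy (hx.trans ht).le)
  rintro w ⟨hw, h0, h1⟩
  exact ⟨hw, (zero_mul _).trans_le h0, h1⟩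

lemma measure_etaFF_mem_cell_le (hL : 2 ≤ L) {I : Set ℝ} (hI : MeasurableSet I) {a b : ℝ}
    (ha : 0 ≤ a) (hab : a ≤ b) :
    μ {w | S.projPower w ∈ I ∧ 0 ≤ S.margin w ∧ S.etaFF w ∈ Ioc a b} ≤
      ENNReal.ofReal (Real.exp (-c.gpMin) * c.marginRate * c.pathGain * cdiBound L B * (b - a)) *
        μ (S.projPower ⁻¹' I) := by
  have hκ := c.marginRate_pos
  have hD := cdiBound_pos L B
  rw [ENNReal.ofReal_mul (by positivity), mul_assoc, ← Measure.map_apply S.measurable_projPower hI,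
    S.map_projPower hL, ← setLIntegral_const]
  refine le_trans (measure_mono ?_) (S.measure_projPower_mem_and_margin_mem_le hL hI
    measurable_const measurable_const (fun _ _ => ha) fun _ _ => hab)
  rintro w ⟨hI, hm, hη⟩
  rw [etaFF, if_pos hm] at hη
  have hgain : 0 < c.pathGain * S.gx w * S.delta w := by
    have hgain0 : 0 ≤ c.pathGain * S.gx w * S.delta w :=
      mul_nonneg (mul_nonneg c.pathGain.2 (S.gx_nonneg w)) (S.delta_nonneg w)
    refine hgain0.lt_of_ne' fun h0 => ?_
    rw [h0, div_zero] at hη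
    exact ha.not_gt hη.1
  exact ⟨hI, ((lt_div_iff₀ hgain).1 hη.1).le, (div_le_iff₀ hgain).1 hη.2⟩

lemma lintegral_map_margin_Ioc_le (hL : 2 ≤ L) {a b : ℝ} (ha : 0 ≤ a) :
    ∫⁻ w, μ.map S.margin (Ioc (a * (c.pathGain * S.gx w * S.epsilon w))
        (b * (c.pathGain * S.gx w * S.epsilon w))) ∂μ ≤
      μ {w | 0 ≤ S.margin w ∧ S.eta w ∈ Ioc a b} := by
  have hlow : Measurable fun z : ℝ × ℝ × ℝ × ℝ × ℝ =>
      a * (c.pathGain * z.2.1 * z.2.2.1) := by fun_prop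
  have hupp : Measurable fun z : ℝ × ℝ × ℝ × ℝ × ℝ =>
      b * (c.pathGain * z.2.1 * z.2.2.1) := by fun_prop
  have hs : MeasurableSet {z : ℝ × ℝ × ℝ × ℝ × ℝ |
      z.1 ∈ Ioc (a * (c.pathGain * z.2.1 * z.2.2.1)) (b * (c.pathGain * z.2.1 * z.2.2.1))} :=
    (measurableSet_lt hlow measurable_fst).inter (measurableSet_le measurable_fst hupp)
  refine (measure_prodMk_mem_of_indepFun S.measurable_margin (by fun_prop)
    S.indepFun_margin_rest hs).symm.trans_le (measure_mono_ae ?_)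
  filter_upwards [S.ae_hx_ne_zero (by omega), S.ae_epsilon_pos hL] with w hx hε hw
  have hgain : 0 < c.pathGain * S.gx w * S.epsilon w :=
    mul_pos (mul_pos c.pathGain_pos (S.gx_pos hx)) hε
  have hm : 0 ≤ S.margin w := (mul_nonneg ha hgain.le).trans hw.1.le
  refine ⟨hm, ?_⟩
  rw [eta, if_pos hm]
  exact ⟨(lt_div_iff₀ hgain).2 hw.1, (div_le_iff₀ hgain).2 hw.2⟩

lemma length_le_measure_eta_mem_cell (hL : 2 ≤ L) {a b : ℝ} (ha : 0 ≤ a) (hab : a ≤ b) :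
    ENNReal.ofReal (Real.exp (-c.gpMin) * (c.marginRate * c.pathGain * (b - a)) *
        (((L : ℝ) - 1) * cdiBound L B)) ≤
      μ {w | 0 ≤ S.margin w ∧ S.eta w ∈ Ioc a b} +
        ENNReal.ofReal (Real.exp (-c.gpMin) * (c.marginRate * c.pathGain * b) ^ 2 *
          (L * (L + 1) * cdiBound L B ^ 2)) := by
  have hκ := c.marginRate_pos
  have hlen : 0 ≤ b - a := sub_nonneg.2 hab
  have hfiber : ∀ᵐ w ∂μ,
      ENNReal.ofReal (Real.exp (-c.gpMin) * (c.marginRate * c.pathGain * (b - a))) *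
          ENNReal.ofReal (S.gx w * S.epsilon w) ≤
        μ.map S.margin (Ioc (a * (c.pathGain * S.gx w * S.epsilon w))
            (b * (c.pathGain * S.gx w * S.epsilon w))) +
          ENNReal.ofReal (Real.exp (-c.gpMin) * (c.marginRate * c.pathGain * b) ^ 2) *
            ENNReal.ofReal ((S.gx w * S.epsilon w) ^ 2) := by
    filter_upwards [S.ae_epsilon_pos hL] with w hε
    have hgain : 0 ≤ c.pathGain * S.gx w * S.epsilon w :=
      mul_nonneg (mul_nonneg c.pathGain.2 (S.gx_nonneg w)) hε.le
    have hgε : 0 ≤ S.gx w * S.epsilon w := mul_nonneg (S.gx_nonneg w) hε.le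
    refine le_trans ?_ (add_le_add_left (S.le_map_margin_Ioc (mul_nonneg ha hgain)
      (mul_le_mul_of_nonneg_right hab hgain)) _)
    rw [← ENNReal.ofReal_mul (by positivity), ← ENNReal.ofReal_mul (by positivity)]
    refine (ENNReal.ofReal_le_ofReal ?_).trans ENNReal.ofReal_add_le
    exact le_of_eq (by ring)
  have hint := lintegral_mono_ae hfiber
  rw [lintegral_const_mul _ (by fun_prop), lintegral_add_right _ (by fun_prop),
    lintegral_const_mul _ (by fun_prop), S.lintegral_gx_mul_epsilon hL,
    ← ENNReal.ofReal_mul (by positivity)] at hint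
  refine hint.trans (add_le_add (S.lintegral_map_margin_Ioc_le hL ha) ?_)
  exact (mul_le_mul_right (S.lintegral_gx_mul_epsilon_sq_le hL) _).trans_eq
    (ENNReal.ofReal_mul (by positivity)).symm

end CellBounds

end CognitiveLink

section Codebook

variable {A : ℕ} {p : ℕ → ℝ}

lemma le_codebookFloor {m : ℕ} (hm : m < 2 ^ A) {x : ℝ} (hx : p m ≤ x) :
    p m ≤ CognitiveLink.codebookFloor A p x :=
  le_csSup ⟨x, fun _ hq => hq.2⟩ ⟨⟨m, hm, rfl⟩, hx⟩

/-- The `n`-th cell of the codebook: the points with floor `p n`. -/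
def codebookCell (A : ℕ) (p : ℕ → ℝ) (n : ℕ) : Set ℝ :=
  {x | p n ≤ x ∧ (n + 1 < 2 ^ A → x < p (n + 1))}

lemma measurableSet_codebookCell (A : ℕ) (p : ℕ → ℝ) (n : ℕ) :
    MeasurableSet (codebookCell A p n) :=
  measurableSet_Ici.inter (MeasurableSet.imp (.const _) measurableSet_Iio)

lemma exists_mem_codebookCell (A : ℕ) {x : ℝ} (hx : p 0 ≤ x) :
    ∃ n < 2 ^ A, x ∈ codebookCell A p n := by
  classical
  have hpos : 0 < 2 ^ A := by positivity
  have hle := Nat.findGreatest_le (P := fun n => p n ≤ x) (2 ^ A - 1)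
  exact ⟨Nat.findGreatest (fun n => p n ≤ x) (2 ^ A - 1), by omega,
    Nat.findGreatest_spec (P := fun n => p n ≤ x) (Nat.zero_le _) hx,
    fun hn => not_le.1 (Nat.findGreatest_is_greatest (P := fun n => p n ≤ x)
      (Nat.lt_succ_self _) (by omega))⟩

lemma pairwiseDisjoint_codebookCell (hp : StrictMonoOn p (Iio (2 ^ A))) :
    (Iio (2 ^ A)).PairwiseDisjoint (codebookCell A p) := by
  have hlt {m n : ℕ} (hmn : m < n) (hn : n < 2 ^ A) :
      Disjoint (codebookCell A p m) (codebookCell A p n) := by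
    have hm : m + 1 < 2 ^ A := by omega
    exact disjoint_left.2 fun x hxm hxn =>
      (hxm.2 hm).not_ge ((hp.monotoneOn hm hn hmn).trans hxn.1)
  intro m hm n hn hmn
  rcases lt_or_gt_of_ne hmn with h | h
  exacts [hlt h hn, (hlt h hm).symm]

/-- The right end of the part of the `n`-th codebook cell below the maximum power `P`. -/
noncomputable def cellEnd (A : ℕ) (p : ℕ → ℝ) (P : ℝ) (n : ℕ) : ℝ :=
  if n + 1 < 2 ^ A then min (p (n + 1)) P else P

lemma cellEnd_le (A : ℕ) (p : ℕ → ℝ) (P : ℝ) (n : ℕ) : cellEnd A p P n ≤ P := by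
  unfold cellEnd
  split_ifs
  exacts [min_le_right _ _, le_rfl]

lemma le_cellEnd_of_codebookFloor_le {P x z : ℝ} {n : ℕ} (hz : z ∈ codebookCell A p n)
    (hxP : x ≤ P) (hxz : CognitiveLink.codebookFloor A p x ≤ z) : x ≤ cellEnd A p P n := by
  unfold cellEnd
  split_ifs with hn
  · refine le_min (le_of_not_gt fun hx => ?_) hxP
    exact (hz.2 hn).not_ge ((le_codebookFloor hn hx.le).trans hxz)
  · exact hxP

end Codebook

lemma exists_orthogonal_norm_inner_sq_eq {E : Type*} [NormedAddCommGroup E]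
    [InnerProductSpace ℂ E] {q : E} (hq : ‖q‖ = 1) (s : E) {P : ℝ} (hP : 0 ≤ P) :
    ∃ v : E, inner ℂ v q = 0 ∧ ‖v‖ ^ 2 ≤ P ∧
      ‖inner ℂ v s‖ ^ 2 = P * ‖rejection q s‖ ^ 2 := by
  set r := rejection q s
  rcases eq_or_ne r 0 with h0 | h0
  · exact ⟨0, by simp, by simpa using hP, by simp [h0]⟩
  have hrq : inner ℂ r q = 0 := inner_eq_zero_symm.1 (inner_rejection_right hq s)
  have hrs : inner ℂ r s = (‖r‖ : ℂ) ^ 2 := by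
    have hs : s = r + inner ℂ q s • q := (sub_add_cancel _ _).symm
    rw [hs, inner_add_right, inner_smul_right, hrq, mul_zero, add_zero,
      inner_self_eq_norm_sq_to_K]
    rfl
  have hrn : ‖r‖ ≠ 0 := norm_ne_zero_iff.2 h0
  refine ⟨((√P / ‖r‖ : ℝ) : ℂ) • r, by rw [inner_smul_left, hrq, mul_zero], ?_, ?_⟩
  · rw [norm_smul, Complex.norm_real, mul_pow, Real.norm_eq_abs, sq_abs, div_pow,
      Real.sq_sqrt hP, div_mul_cancel₀ _ (pow_ne_zero 2 hrn)]
  · rw [inner_smul_left, hrs, Complex.conj_ofReal, norm_mul, mul_pow, Complex.norm_real,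
      Real.norm_eq_abs, sq_abs, div_pow, Real.sq_sqrt hP, norm_pow, Complex.norm_real, norm_norm]
    field_simp

namespace LinkParams

variable (c : LinkParams)

lemma outageGain_pos : 0 < c.thetaS / c.gammaMax := div_pos c.thetaS_pos c.gammaMax_pos

lemma div_lt_powerMax {t : ℝ} (ht : c.thetaS / c.gammaMax < t) :
    c.thetaS * c.noise / t < c.powerMax := by
  have ht0 := c.outageGain_pos.trans ht
  rw [gammaMax, div_div_eq_mul_div] at ht
  exact (div_lt_comm₀ c.powerMax_pos ht0).1 ht

/-- The coefficient of `2 ^ (-2 B / (L - 1))` in the expansion of the conditional probability of a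
codebook cell. -/
noncomputable def cellErrorCoeff (L : ℕ) : ℝ :=
  (c.marginRate * c.pathGain * c.powerMax) ^ 2 * (L * (L + 1))

end LinkParams

namespace CognitiveLink

variable {L : ℕ} {c : LinkParams} {B : ℕ} {Ω : Type*} [MeasurableSpace Ω] {μ : Measure Ω}
  (S : CognitiveLink L c B μ)

section Outage

/-- The part of the outage event due to a small unquantized signal: `etaFF` is at most the power
`θ_s σ² / projPower` that is needed. -/
def smallSignal : Set Ω :=
  {w | c.thetaS / c.gammaMax < S.projPower w ∧ 0 ≤ S.margin w ∧
    S.margin w ≤ c.thetaS * c.noise / S.projPower w * (c.pathGain * S.gx w * S.delta w)}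

/-- The part of the outage event due to quantization: the needed power `θ_s σ² / projPower` and the
unquantized signal lie in the `n`-th codebook cell. -/
def sharedCell (A : ℕ) (p : ℕ → ℝ) (n : ℕ) : Set Ω :=
  {w | S.projPower w ∈
      Ioi (c.thetaS / c.gammaMax) ∩ (c.thetaS * c.noise / ·) ⁻¹' codebookCell A p n ∧
    0 ≤ S.margin w ∧ S.etaFF w ∈ Ioc (p n) (cellEnd A p c.powerMax n)}

variable {S} {A : ℕ} {p : ℕ → ℝ}

lemma IsIPCCodebook.strictMonoOn (hp : S.IsIPCCodebook A p) : StrictMonoOn p (Iio (2 ^ A)) :=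
  strictMonoOn_of_lt_succ ordConnected_Iio fun n _ _ hn => hp.lt_succ n hn

lemma IsIPCCodebook.nonneg (hp : S.IsIPCCodebook A p) {n : ℕ} (hn : n < 2 ^ A) : 0 ≤ p n :=
  hp.zero ▸ hp.strictMonoOn.monotoneOn (mem_Iio.2 (by positivity)) hn (Nat.zero_le n)

lemma etaFFQuant_nonneg (hp : S.IsIPCCodebook A p) (w : Ω) : 0 ≤ S.etaFFQuant A p w := by
  unfold etaFFQuant
  split_ifs with h
  · have hη : 0 ≤ S.etaFF w := by
      rw [etaFF, if_pos h.1]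
      exact div_nonneg h.1
        (mul_nonneg (mul_nonneg c.pathGain.2 (S.gx_nonneg w)) (S.delta_nonneg w))
    have hfloor := le_codebookFloor (A := A) (p := p) (by positivity) (hp.zero.trans_le hη)
    rwa [hp.zero] at hfloor
  · exact c.powerMax_pos.le

variable (S) in
lemma gs_mul_norm_rejection_ss_sq (w : Ω) :
    S.gs w * ‖rejection (S.sxHat w) (S.ss w)‖ ^ 2 = S.projPower w := by
  have hss : S.hs w = (‖S.hs w‖ : ℂ) • S.ss w := by
    rcases eq_or_ne (S.hs w) 0 with h | h
    · simp [h]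
    · rw [ss, channelShape, smul_inv_smul₀ (by exact_mod_cast norm_ne_zero_iff.2 h)]
  rw [projPower, hss, rejection_smul, norm_smul, mul_pow, Complex.norm_real, norm_norm, gs]

lemma IsOCBBeamformer.le_snrS {P : Ω → ℝ} {f : Ω → EuclideanSpace ℂ (Fin L)}
    (hf : S.IsOCBBeamformer P f) {w : Ω} (hw : S.hx w ≠ 0) (hP : 0 ≤ P w) :
    P w * S.projPower w / c.noise ≤ S.snrS f w := by
  obtain ⟨v, hv, hvP, hvs⟩ := exists_orthogonal_norm_inner_sq_eq (S.norm_sxHat hw) (S.ss w) hP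
  have hgs : 0 ≤ S.gs w / c.noise := div_nonneg (sq_nonneg _) c.noise_pos.le
  calc P w * S.projPower w / c.noise = S.gs w / c.noise * ‖inner ℂ v (S.ss w)‖ ^ 2 := by
        rw [hvs, ← S.gs_mul_norm_rejection_ss_sq]
        ring
    _ ≤ S.snrS f w := mul_le_mul_of_nonneg_left ((hf w).2 ⟨hv, hvP⟩) hgs

lemma IsOCBBeamformer.etaFFQuant_le (hp : S.IsIPCCodebook A p)
    {f : Ω → EuclideanSpace ℂ (Fin L)} (hf : S.IsOCBBeamformer (S.etaFFQuant A p) f) {w : Ω}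
    (hw : S.hx w ≠ 0) (hG : 0 < S.projPower w) (hout : S.snrS f w ≤ c.thetaS) :
    S.etaFFQuant A p w ≤ c.thetaS * c.noise / S.projPower w := by
  rw [le_div_iff₀ hG, ← div_le_iff₀ c.noise_pos]
  exact (hf.le_snrS hw (etaFFQuant_nonneg hp w)).trans hout

lemma outage_cases (hp : S.IsIPCCodebook A p)
    {f : Ω → EuclideanSpace ℂ (Fin L)} (hf : S.IsOCBBeamformer (S.etaFFQuant A p) f)
    {w : Ω} (hw : S.hx w ≠ 0) (hδ : S.delta w ≠ 0) (hout : S.snrS f w ≤ c.thetaS) :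
    S.projPower w ≤ c.thetaS / c.gammaMax ∨ w ∈ S.smallSignal ∨
      ∃ n < 2 ^ A, w ∈ S.sharedCell A p n := by
  rcases le_or_gt (S.projPower w) (c.thetaS / c.gammaMax) with hG | hG
  · exact Or.inl hG
  right
  have hG0 := c.outageGain_pos.trans hG
  have hη := hf.etaFFQuant_le hp hw hG0 hout
  have hreq := c.div_lt_powerMax hG
  have hreq0 : 0 ≤ c.thetaS * c.noise / S.projPower w :=
    div_nonneg (mul_pos c.thetaS_pos c.noise_pos).le hG0.le
  unfold etaFFQuant at hη
  split_ifs at hη with hquant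
  swap
  · exact absurd hη hreq.not_ge
  obtain ⟨hm, hlt⟩ := hquant
  rcases le_or_gt (S.etaFF w) (c.thetaS * c.noise / S.projPower w) with hle | hgt
  · have hgain : 0 < c.pathGain * S.gx w * S.delta w := mul_pos
      (mul_pos c.pathGain_pos (S.gx_pos hw)) ((S.delta_nonneg w).lt_of_ne' hδ)
    rw [etaFF, if_pos hm, div_le_iff₀ hgain] at hle
    exact Or.inl ⟨hG, hm, hle⟩
  · obtain ⟨n, hn, hcell⟩ := exists_mem_codebookCell A (hp.zero.trans_le hreq0)
    exact Or.inr ⟨n, hn, ⟨hG, hcell⟩, hm, hcell.1.trans_lt hgt,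
      le_cellEnd_of_codebookFloor_le hcell hlt.le hη⟩

end Outage

end CognitiveLink

namespace LinkParams

variable (c : LinkParams)

lemma alpha_eq (L : ℕ) :
    c.alpha L = Real.exp (-c.gpMin) *
      (upperGamma ((L : ℝ) - 1) (c.thetaS / c.gammaMax) / Real.Gamma ((L : ℝ) - 1)) := rfl

lemma phi_eq (L : ℕ) :
    c.phi L = ((L : ℝ) - 1) * (Real.exp (-c.gpMin) * c.marginRate * c.pathGain *
      (c.thetaS * c.noise * (upperGamma ((L : ℝ) - 2) (c.thetaS / c.gammaMax) /
        Real.Gamma ((L : ℝ) - 1)))) := by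
  have := c.noise_pos
  rw [phi, marginRate, gpMin]
  field_simp

end LinkParams

namespace CognitiveLink

variable {L : ℕ} {c : LinkParams} {B : ℕ} {Ω : Type*} [MeasurableSpace Ω] {μ : Measure Ω}
  {S : CognitiveLink L c B μ} {A : ℕ} {p : ℕ → ℝ}

variable [IsProbabilityMeasure μ]

variable (S) in
lemma measure_inter_of_cond {t : Set Ω} {x : ℝ}
    (h : (cond μ {w | c.thetaP ≤ c.gammaP * S.gp w}).real t = x) :
    μ ({w | c.thetaP ≤ c.gammaP * S.gp w} ∩ t) = ENNReal.ofReal (Real.exp (-c.gpMin) * x) := by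
  have hs : MeasurableSet {w | c.thetaP ≤ c.gammaP * S.gp w} :=
    measurableSet_le (by fun_prop) (by fun_prop)
  have hmargin := S.measure_margin_nonneg
  simp only [margin_nonneg_iff] at hmargin
  rw [← cond_mul_eq_inter hs t μ, hmargin, ← h, mul_comm,
    ENNReal.ofReal_mul (by positivity), ofReal_measureReal]

lemma IsIPCCodebook.measure_eta_mem_cell_le (hp : S.IsIPCCodebook A p) {n : ℕ} (hn : n < 2 ^ A) :
    μ {w | 0 ≤ S.margin w ∧ S.eta w ∈ Ioc (p n) (cellEnd A p c.powerMax n)} ≤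
      ENNReal.ofReal (Real.exp (-c.gpMin) * (1 / 2 ^ A)) := by
  by_cases h : n + 1 < 2 ^ A
  · rw [← S.measure_inter_of_cond (hp.cell n h)]
    refine measure_mono fun w hw => ⟨(S.margin_nonneg_iff w).1 hw.1, hw.2.1, ?_⟩
    have hle := hw.2.2
    rw [cellEnd, if_pos h] at hle
    exact hle.trans (min_le_left _ _)
  · obtain rfl : n = 2 ^ A - 1 := by omega
    rw [← S.measure_inter_of_cond hp.last]
    exact measure_mono fun w hw => ⟨(S.margin_nonneg_iff w).1 hw.1, hw.2.1⟩

lemma IsIPCCodebook.cell_length_le (hL : 2 ≤ L) (hp : S.IsIPCCodebook A p) {n : ℕ}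
    (hn : n < 2 ^ A) (hle : p n ≤ cellEnd A p c.powerMax n) :
    c.marginRate * c.pathGain * cdiBound L B * (cellEnd A p c.powerMax n - p n) ≤
      (1 / 2 ^ A + c.cellErrorCoeff L * cdiBound L B ^ 2) / (L - 1) := by
  have hκ := c.marginRate_pos
  have hD := cdiBound_pos L B
  have hpn := hp.nonneg hn
  have hend := cellEnd_le A p c.powerMax n
  have hend0 := hpn.trans hle
  have hlen := (S.length_le_measure_eta_mem_cell hL hpn hle).trans
    (add_le_add (hp.measure_eta_mem_cell_le hn) le_rfl)
  rw [← ENNReal.ofReal_add (by positivity) (by positivity),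
    ENNReal.ofReal_le_ofReal_iff (by positivity)] at hlen
  simp only [mul_assoc (Real.exp (-c.gpMin)), ← mul_add] at hlen
  have hlen := le_of_mul_le_mul_left hlen (Real.exp_pos _)
  have herror : (c.marginRate * c.pathGain * cellEnd A p c.powerMax n) ^ 2 *
      (L * (L + 1) * cdiBound L B ^ 2) ≤ c.cellErrorCoeff L * cdiBound L B ^ 2 := by
    rw [LinkParams.cellErrorCoeff, mul_assoc (_ ^ 2) ((L : ℝ) * (L + 1))]
    gcongr
  rw [le_div_iff₀ (natCast_sub_one_pos hL)]
  linarith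

lemma IsIPCCodebook.measure_etaFF_mem_cell_le (hL : 2 ≤ L) (hp : S.IsIPCCodebook A p) {n : ℕ}
    (hn : n < 2 ^ A) {I : Set ℝ} (hI : MeasurableSet I) :
    μ {w | S.projPower w ∈ I ∧ 0 ≤ S.margin w ∧
        S.etaFF w ∈ Ioc (p n) (cellEnd A p c.powerMax n)} ≤
      ENNReal.ofReal (Real.exp (-c.gpMin) *
        ((1 / 2 ^ A + c.cellErrorCoeff L * cdiBound L B ^ 2) / (L - 1))) *
          μ (S.projPower ⁻¹' I) := by
  rcases le_or_gt (p n) (cellEnd A p c.powerMax n) with hle | hlt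
  · refine (S.measure_etaFF_mem_cell_le hL hI (hp.nonneg hn) hle).trans
      (mul_le_mul_left (ENNReal.ofReal_le_ofReal ?_) _)
    simp only [mul_assoc (Real.exp _)]
    exact mul_le_mul_of_nonneg_left (hp.cell_length_le hL hn hle) (Real.exp_pos _).le
  · simp [Ioc_eq_empty hlt.not_gt]

lemma IsIPCCodebook.measure_iUnion_sharedCell_le (hL : 2 ≤ L) (hp : S.IsIPCCodebook A p) :
    μ (⋃ n ∈ Finset.range (2 ^ A), S.sharedCell A p n) ≤
      ENNReal.ofReal (Real.exp (-c.gpMin) *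
        ((1 / 2 ^ A + c.cellErrorCoeff L * cdiBound L B ^ 2) / (L - 1))) *
          μ {w | c.thetaS / c.gammaMax < S.projPower w} := by
  let I (n : ℕ) : Set ℝ :=
    Ioi (c.thetaS / c.gammaMax) ∩ (c.thetaS * c.noise / ·) ⁻¹' codebookCell A p n
  have hI (n : ℕ) : MeasurableSet (I n) := measurableSet_Ioi.inter
    ((measurableSet_codebookCell A p n).preimage (by fun_prop))
  have hdisj : (↑(Finset.range (2 ^ A)) : Set ℕ).PairwiseDisjoint
      fun n => S.projPower ⁻¹' I n := by
    rw [Finset.coe_range]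
    exact fun m hm n hn hmn => (((pairwiseDisjoint_codebookCell hp.strictMonoOn hm hn hmn).preimage
      _).mono inter_subset_right inter_subset_right).preimage S.projPower
  refine (measure_biUnion_finset_le _ _).trans ((Finset.sum_le_sum fun n hn =>
    hp.measure_etaFF_mem_cell_le hL (Finset.mem_range.1 hn) (hI n)).trans ?_)
  rw [← Finset.mul_sum, ← measure_biUnion_finset hdisj fun n _ => S.measurable_projPower (hI n)]
  gcongr
  exact iUnion₂_subset fun n _ w hw => hw.1

variable (S) in
lemma measureReal_lt_projPower (hL : 2 ≤ L) {x : ℝ} (hx : 0 < x) :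
    μ.real {w | x < S.projPower w} =
      upperGamma ((L : ℝ) - 1) x / Real.Gamma ((L : ℝ) - 1) := by
  have hL1 := natCast_sub_one_pos hL
  have hpre : {w | x < S.projPower w} = S.projPower ⁻¹' Ioi x := rfl
  rw [hpre, ← map_measureReal_apply S.measurable_projPower measurableSet_Ioi, S.map_projPower hL,
    measureReal_def, gammaMeasure_Ioi hL1 hx, ENNReal.toReal_ofReal
      (div_nonneg (upperGamma_nonneg _ hx.le) (Real.Gamma_pos_of_pos hL1).le)]

variable (S) in
lemma measureReal_projPower_le (hL : 2 ≤ L) {x : ℝ} (hx : 0 < x) :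
    μ.real {w | S.projPower w ≤ x} =
      1 - upperGamma ((L : ℝ) - 1) x / Real.Gamma ((L : ℝ) - 1) := by
  rw [← S.measureReal_lt_projPower hL hx, ← probReal_compl_eq_one_sub
    (measurableSet_lt measurable_const S.measurable_projPower)]
  simp only [compl_ofPred, not_lt]

variable (S) in
lemma measureReal_smallSignal_le (hL : 2 ≤ L) :
    μ.real S.smallSignal ≤ c.phi L * cdiBound L B / (L - 1) := by
  have hL1 := natCast_sub_one_pos hL
  have hκ := c.marginRate_pos
  have hD := cdiBound_pos L B
  have hy := (mul_pos c.thetaS_pos c.noise_pos).le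
  have hΓ := div_nonneg (upperGamma_nonneg ((L : ℝ) - 2) c.outageGain_pos.le)
    (Real.Gamma_pos_of_pos hL1).le
  refine (ENNReal.toReal_le_of_le_ofReal (by positivity)
    (S.measure_outage_etaFF_le hL c.outageGain_pos hy)).trans_eq ?_
  rw [c.phi_eq]
  field_simp

lemma IsIPCCodebook.measureReal_iUnion_sharedCell_le (hL : 2 ≤ L) (hp : S.IsIPCCodebook A p) :
    μ.real (⋃ n ∈ Finset.range (2 ^ A), S.sharedCell A p n) ≤
      c.alpha L * ((1 / 2 ^ A + c.cellErrorCoeff L * cdiBound L B ^ 2) / (L - 1)) := by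
  have hL1 := natCast_sub_one_pos hL
  have hcoeff : 0 ≤ c.cellErrorCoeff L := by
    unfold LinkParams.cellErrorCoeff
    positivity
  refine (ENNReal.toReal_mono (by finiteness) (hp.measure_iUnion_sharedCell_le hL)).trans_eq ?_
  rw [ENNReal.toReal_mul, ENNReal.toReal_ofReal (by positivity), c.alpha_eq,
    ← S.measureReal_lt_projPower hL c.outageGain_pos, mul_right_comm]
  rfl

lemma IsOCBBeamformer.outageS_le (hL : 2 ≤ L) (hp : S.IsIPCCodebook A p)
    {f : Ω → EuclideanSpace ℂ (Fin L)} (hf : S.IsOCBBeamformer (S.etaFFQuant A p) f) :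
    S.outageS f ≤
      1 - upperGamma ((L : ℝ) - 1) (c.thetaS / c.gammaMax) / Real.Gamma ((L : ℝ) - 1) +
        (c.phi L * cdiBound L B / (L - 1) +
          c.alpha L * ((1 / 2 ^ A + c.cellErrorCoeff L * cdiBound L B ^ 2) / (L - 1))) := by
  have hsub : {w | S.snrS f w ≤ c.thetaS} ≤ᵐ[μ]
      ({w | S.projPower w ≤ c.thetaS / c.gammaMax} ∪
        (S.smallSignal ∪ ⋃ n ∈ Finset.range (2 ^ A), S.sharedCell A p n) : Set Ω) := by
    filter_upwards [S.ae_hx_ne_zero (by omega), S.ae_delta_ne_zero hL] with w hw hδ hout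
    refine (outage_cases hp hf hw hδ hout).imp id (Or.imp id ?_)
    rintro ⟨n, hn, h⟩
    exact mem_iUnion₂.2 ⟨n, Finset.mem_range.2 hn, h⟩
  calc S.outageS f ≤ _ := ENNReal.toReal_mono (measure_ne_top _ _) (measure_mono_ae hsub)
    _ ≤ _ := (measureReal_union_le _ _).trans (add_le_add le_rfl (measureReal_union_le _ _))
    _ ≤ _ := add_le_add (S.measureReal_projPower_le hL c.outageGain_pos).le
      (add_le_add (S.measureReal_smallSignal_le hL) (hp.measureReal_iUnion_sharedCell_le hL))

end CognitiveLink

theorem mainTheorem5 (L : ℕ) (hL : 2 ≤ L) (c : LinkParams) :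
    ∃ C : ℝ, ∀ (A B : ℕ) (Ω : Type*) [MeasurableSpace Ω] (μ : Measure Ω)
      [IsProbabilityMeasure μ] (S : CognitiveLink L c B μ) (p : ℕ → ℝ)
      (_ : S.IsIPCCodebook A p) (f : Ω → EuclideanSpace ℂ (Fin L))
      (_ : S.IsOCBBeamformer (S.etaFFQuant A p) f),
      S.outageS f ≤
        1 - upperGamma ((L : ℝ) - 1) (c.thetaS / c.gammaMax) / Real.Gamma ((L : ℝ) - 1)
          + (c.phi L * (2 : ℝ) ^ (-((B : ℝ) / ((L : ℝ) - 1)))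
              + c.alpha L * (2 : ℝ) ^ (-(A : ℝ))) / ((L : ℝ) - 1)
          + C * (2 : ℝ) ^ (-(2 * (B : ℝ) / ((L : ℝ) - 1))) := by
  refine ⟨c.alpha L * c.cellErrorCoeff L / (L - 1), fun A B Ω _ μ _ S p hp f hf => ?_⟩
  have hA : (2 : ℝ) ^ (-(A : ℝ)) = 1 / 2 ^ A := by
    rw [Real.rpow_neg two_pos.le, Real.rpow_natCast, one_div]
  have hB : (2 : ℝ) ^ (-(2 * (B : ℝ) / ((L : ℝ) - 1))) = cdiBound L B ^ 2 := by
    rw [cdiBound, ← Real.rpow_mul_natCast two_pos.le]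
    push_cast
    ring_nf
  rw [hA, hB, ← cdiBound]
  refine (hf.outageS_le hL hp).trans_eq ?_
  ring
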